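/- **Setting.** A variety of finite groups is a nonempty class $\mathcal C$ of finite groups closed under isomorphism, subgroups, quotients and finite direct products; $\pi(\mathcal C)$ is the set of primes dividing the order of some group in $\mathcal C$; a profinite group is pro-$\mathcal C$ if its quotients by open normal subgroups lie in $\mathcal C$. Let $G$ be a pro-$\mathcal C$ group, $X$ a profinite space, and $\mathcal S=\{S_x\}_{x\in X}$ a family of closed subgroups of $G$ continuously indexed by $X$, i.e. $\mathcal S=\{(s,x)\in G\times X: s\in S_x\}$ is closed in $G\times X$. Let $\pi\supseteq\pi(\mathcal C)$ be a set of primes, $\mathbb Z_\pi=\prod_{p\in\pi}\mathbb Z_p$, let $G/\mathcal S=\bigsqcup_x G/S_x$ have the quotient topology from $G\times X$, and let $\Delta$ be the kernel of the augmentation $\mathrm{ev}\colon\mathbb Z_\pi[\![G/\mathcal S]\!]\to\mathbb Z_\pi$, where $\mathbb Z_\pi[\![G/\mathcal S]\!]$ is the free profinite $\mathbb Z_\pi$-module on $G/\mathcal S$. For a discrete torsion $G$-module $A$ and $n\ge 1$ put $H^n(G,\mathcal S;A)=H^{n-1}(G;\mathrm{Hom}(\Delta,A))$ (continuous homomorphisms,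 diagonal action, continuous cochains) if $X\neq\emptyset$, and, as usual, $H^n(G,\emptyset;A)=H^n(G;A)$. For $p\in\pi$ write $\mathrm{cd}_p(G,\mathcal S)\le n$ if $H^{n+1}(G,\mathcal S;A)=0$ for every discrete $p$-primary $G$-module $A$. **Relative extensions.** A relative extension of $(G,\mathcal S)$ by a finite $G$-module $A$ is an extension $0\to A\to E\xrightarrow{p} G\to 1$ of profinite groups inducing the given action on $A$, with a continuous map $q\colon\mathcal S\to E$ restricting to homomorphisms $q_x\colon S_x\to E$ with $pq_x=\mathrm{id}$. Two of them, $(E,q)$ and $(\tilde E,\tilde q)$, are equivalent if there are a continuous equivalence of extensions $f\colon E\to\tilde E$ and a continuous $a\colon X\to A$ with $\tilde q_x(s)=a_x\,f(q_x(s))\,a_x^{-1}$ for all $x\in X$, $s\in S_x$. For a class $[\xi]\in H^2(G,\mathcal S;A)$, choose a continuous $\eta\colon G\to\mathrm{Hom}(\mathbb Z_\pi[\![G/\mathcal S]\!],A)$ restricting to the 1-cocycle $\xi\colon G\to\mathrm{Hom}(\Delta,A)$, and the 2-cocycle $\zeta\colon G^2\to A$ with $\mathrm{ev}^*\zeta=d\eta$;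 then $(E,q)$ represents $[\xi]$ if it is equivalent to the extension $E_\zeta=A\times G$ with product $(a,g)(b,h)=(a+gb+\zeta(g,h),gh)$ and $q(s,x)=(-\eta(s)(1S_x),s)$. (If $X=\emptyset$, the class represented by $E_\zeta$ is $[\zeta]\in H^2(G;A)$.) **Lifting problems.** A pro-$\mathcal C$ lifting problem of $G$ relative to $\mathcal S$ consists of a continuous surjection $\alpha\colon H\to Q$ of pro-$\mathcal C$ groups, a continuous homomorphism $\phi\colon G\to Q$ and a continuous map $\sigma\colon\mathcal S\to H$ that is a homomorphism on each $S_x$ and satisfies $\alpha\sigma(s,x)=\phi(s)$; its kernel is $\ker\alpha$. A solution consists of a continuous homomorphism $\bar\phi\colon G\to H$ with $\alpha\bar\phi=\phi$ and a continuous $c\colon X\to\ker\alpha$ with $c(x)\bar\phi(s)c(x)^{-1}=\sigma(s,x)$ for all $x\in X$, $s\in S_x$. If $A=\ker\alpha$ is finite and abelian, it is a $G$-module via $\phi$ and conjugation in $H$, and the pullback relative extension is $E=\{(g,h)\in G\times H:\phi(g)=\alpha(h)\}$ with $q(s,x)=(s,\sigma(s,x))$. **Proposition.** For a pro-$\mathcal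 C$ lifting problem of $G$ relative to $\mathcal S$ with finite abelian kernel $A$, the pullback relative extension represents exactly one class in $H^2(G,\mathcal S;A)$, and the lifting problem has a solution if and only if this class is zero. **Corollary.** If $\mathrm{cd}_p(G,\mathcal S)\le 1$ for every $p\in\pi(\mathcal C)$, then every pro-$\mathcal C$ lifting problem of $G$ relative to $\mathcal S$ with finite abelian kernel has a solution. If $\mathcal C$ is moreover closed under extensions, then the following are equivalent: (i) every pro-$\mathcal C$ lifting problem of $G$ relative to $\mathcal S$ with finite abelian kernel has a solution; (ii) $\mathrm{cd}_p(G,\mathcal S)\le 1$ for every $p\in\pi(\mathcal C)$. -/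

import Mathlib

universe u

set_option linter.unusedSectionVars false

open Topology

namespace RelCoh

noncomputable section

/-! ## Varieties of finite groups and pro-`𝒞` groups -/

/-- A variety of finite groups: a nonempty class of finite groups closed under isomorphism,
subgroups, quotients and finite direct products. -/
structure FiniteGroupVariety where
  Mem : (Γ : Type) → [Group Γ] → Prop
  finite : ∀ (Γ : Type) [Group Γ], Mem Γ → Finite Γ
  of_equiv : ∀ (Γ Γ' : Type) [Group Γ] [Group Γ'], Γ ≃* Γ' → Mem Γ → Mem Γ'
  trivial : Mem PUnit
  subgroup : ∀ (Γ : Type) [Group Γ] (Λ : Subgroup Γ), Mem Γ → Mem Λ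
  quotient : ∀ (Γ : Type) [Group Γ] (N : Subgroup Γ) [N.Normal], Mem Γ → Mem (Γ ⧸ N)
  prod : ∀ (Γ Γ' : Type) [Group Γ] [Group Γ'], Mem Γ → Mem Γ' → Mem (Γ × Γ')

namespace FiniteGroupVariety

variable (C : FiniteGroupVariety)

/-- Membership in the variety for groups in an arbitrary universe, up to isomorphism. -/
def Contains (Γ : Type*) [Group Γ] : Prop :=
  ∃ (Γ₀ : Type) (_ : Group Γ₀), C.Mem Γ₀ ∧ Nonempty (Γ ≃* Γ₀)

/-- The set `π(𝒞)` of primes which divide the order of some group in `𝒞`. -/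
def primes : Set Nat.Primes :=
  {p | ∃ (Γ : Type) (_ : Group Γ), C.Mem Γ ∧ (p : ℕ) ∣ Nat.card Γ}

/-- `𝒞` is closed under extensions. -/
def ExtensionClosed : Prop :=
  ∀ (Γ : Type) [Group Γ] (N : Subgroup Γ) [N.Normal], C.Mem N → C.Mem (Γ ⧸ N) → C.Mem Γ

/-- A profinite group is pro-`𝒞` if all its quotients by open normal subgroups lie in `𝒞`. -/
def IsPro (Γ : Type*) [Group Γ] [TopologicalSpace Γ] : Prop :=
  ∀ (N : Subgroup Γ) [N.Normal], IsOpen (N : Set Γ) → C.Contains (Γ ⧸ N)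

end FiniteGroupVariety

/-! ## Continuous cohomology with coefficients in a discrete module -/

section Cohomology

variable (G M : Type*) [Group G] [TopologicalSpace G] [AddCommGroup M] [DistribMulAction G M]

/-- The differential on inhomogeneous cochains,
`(df)(g₀,…,gₙ) = g₀ f(g₁,…,gₙ) + ∑ⱼ (-1)^(j+1) f(…,gⱼgⱼ₊₁,…)`, where the summand for `j = n`
is `(-1)^(n+1) f(g₀,…,gₙ₋₁)`. -/
def cochainD (n : ℕ) : ((Fin n → G) → M) →+ ((Fin (n + 1) → G) → M) where
  toFun f g := g 0 • f (fun i => g i.succ) +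
    ∑ j : Fin (n + 1), (-1 : ℤ) ^ ((j : ℕ) + 1) • f (Fin.contractNth j (· * ·) g)
  map_zero' := by ext; simp
  map_add' f f' := by
    ext; simp [Finset.sum_add_distrib, add_add_add_comm]

/-- Continuous cochains with values in `M`, where `M` carries the discrete topology. -/
def cochains (n : ℕ) : AddSubgroup ((Fin n → G) → M) where
  carrier := {f | IsLocallyConstant f}
  zero_mem' := IsLocallyConstant.const 0
  add_mem' hf hf' := hf.add hf'
  neg_mem' hf := hf.neg

/-- Continuous cocycles. -/
def cocycles (n : ℕ) : AddSubgroup ((Fin n → G) → M) :=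
  cochains G M n ⊓ (cochainD G M n).ker

/-- Coboundaries of continuous cochains. -/
def coboundaries : (n : ℕ) → AddSubgroup ((Fin n → G) → M)
  | 0 => ⊥
  | n + 1 => (cochains G M n).map (cochainD G M n)

/-- `Hⁿ(G; M)` for a discrete `G`-module `M`. -/
abbrev Cohomology (n : ℕ) : Type _ :=
  cocycles G M n ⧸ (coboundaries G M n).addSubgroupOf (cocycles G M n)

end Cohomology

/-! ## Groups of continuous homomorphisms -/

section CHom

/-- The group `Hom(M, A)` of continuous homomorphisms. -/
def CHom (M A : Type*) [AddCommGroup M] [TopologicalSpace M] [AddCommGroup A]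
    [TopologicalSpace A] : Type _ := M →ₜ+ A

variable {M A : Type*} [AddCommGroup M] [TopologicalSpace M] [AddCommGroup A] [TopologicalSpace A]

instance : FunLike (CHom M A) M A := inferInstanceAs (FunLike (M →ₜ+ A) M A)

instance : AddMonoidHomClass (CHom M A) M A :=
  inferInstanceAs (AddMonoidHomClass (M →ₜ+ A) M A)

instance : ContinuousMapClass (CHom M A) M A :=
  inferInstanceAs (ContinuousMapClass (M →ₜ+ A) M A)

theorem CHom.ext {φ ψ : CHom M A} (h : ∀ m, φ m = ψ m) : φ = ψ := DFunLike.ext _ _ h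

variable [IsTopologicalAddGroup A]

instance : AddCommGroup (CHom M A) := inferInstanceAs (AddCommGroup (M →ₜ+ A))

@[simp] theorem CHom.add_apply (φ ψ : CHom M A) (m : M) : (φ + ψ) m = φ m + ψ m := rfl

@[simp] theorem CHom.neg_apply (φ : CHom M A) (m : M) : (-φ) m = -φ m := rfl

@[simp] theorem CHom.zero_apply (m : M) : (0 : CHom M A) m = 0 := rfl

variable {G : Type*} [Group G] [DistribMulAction G M] [ContinuousConstSMul G M]
  [DistribMulAction G A] [ContinuousConstSMul G A]

/-- The diagonal action `(g φ)(m) = g φ(g⁻¹ m)`. -/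
instance : SMul G (CHom M A) where
  smul g φ :=
    { toFun := fun m => g • φ (g⁻¹ • m)
      map_zero' := by simp
      map_add' := by simp
      continuous_toFun :=
        ((map_continuous φ).comp (continuous_const_smul g⁻¹)).const_smul g }

@[simp] theorem CHom.smul_apply (g : G) (φ : CHom M A) (m : M) :
    (g • φ) m = g • φ (g⁻¹ • m) := rfl

instance : DistribMulAction G (CHom M A) where
  one_smul φ := CHom.ext fun m => by simp
  mul_smul g h φ := CHom.ext fun m => by simp [mul_smul]
  smul_zero g := CHom.ext fun m => by simp
  smul_add g φ ψ := CHom.ext fun m => by simp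

end CHom

/-! ## Free profinite modules -/

instance factPrime (p : Nat.Primes) : Fact (p : ℕ).Prime := ⟨p.2⟩

/-- The ring `ℤ_π = ∏_{p ∈ π} ℤ_p`. -/
abbrev ZPi (π : Set Nat.Primes) : Type := (p : π) → ℤ_[((p : Nat.Primes) : ℕ)]

section Free

variable (π : Set Nat.Primes) (Z : Type u) [TopologicalSpace Z]

/-- The free profinite module `ℤ_π⟦Z⟧` on a profinite space `Z`, as the group of `ℤ_π`-valued
measures on `Z`: additive maps from the locally constant functions `Z → ℤ` to `ℤ_π`, with the
topology of pointwise convergence. (Equivalently the inverse limit of the free modules `ℤ_π[Q]`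
over the finite discrete quotients `Q` of `Z`: the coefficient of `μ` at `q ∈ Q` is the value of
`μ` on the indicator function of the fibre over `q`.) -/
def FreeMod : Type u := LocallyConstant Z ℤ →+ ZPi π

instance : AddCommGroup (FreeMod π Z) :=
  inferInstanceAs (AddCommGroup (LocallyConstant Z ℤ →+ ZPi π))

instance : FunLike (FreeMod π Z) (LocallyConstant Z ℤ) (ZPi π) :=
  inferInstanceAs (FunLike (LocallyConstant Z ℤ →+ ZPi π) (LocallyConstant Z ℤ) (ZPi π))

instance : AddMonoidHomClass (FreeMod π Z) (LocallyConstant Z ℤ) (ZPi π) :=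
  inferInstanceAs (AddMonoidHomClass (LocallyConstant Z ℤ →+ ZPi π) (LocallyConstant Z ℤ) (ZPi π))

instance : TopologicalSpace (FreeMod π Z) :=
  TopologicalSpace.induced (fun μ (f : LocallyConstant Z ℤ) => μ f) inferInstance

variable {π Z}

theorem FreeMod.ext {μ ν : FreeMod π Z} (h : ∀ f, μ f = ν f) : μ = ν := DFunLike.ext _ _ h

variable (π) in
/-- The canonical basis map `Z → ℤ_π⟦Z⟧`, sending `z` to the point mass at `z`. -/
def FreeMod.basis (z : Z) : FreeMod π Z :=
  AddMonoidHom.mk' (fun f => ((f z : ℤ) : ZPi π)) (fun f g => by simp)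

@[simp] theorem FreeMod.basis_apply (z : Z) (f : LocallyConstant Z ℤ) :
    FreeMod.basis π z f = ((f z : ℤ) : ZPi π) := rfl

theorem FreeMod.continuous_basis : Continuous (FreeMod.basis π : Z → FreeMod π Z) := by
  refine continuous_induced_rng.2 (continuous_pi fun f => ?_)
  exact (continuous_of_discreteTopology (f := fun k : ℤ => (k : ZPi π))).comp f.continuous

variable (π Z) in
/-- The augmentation `ev : ℤ_π⟦Z⟧ → ℤ_π`, sending each basis element to `1`. -/
def ev : FreeMod π Z →+ ZPi π where
  toFun μ := μ (LocallyConstant.const Z 1)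
  map_zero' := rfl
  map_add' _ _ := rfl

@[simp] theorem ev_basis (z : Z) : ev π Z (FreeMod.basis π z) = 1 := by
  change ((1 : ℤ) : ZPi π) = 1
  simp

variable (π Z) in
/-- The kernel `Δ` of the augmentation. -/
def Delta : Type u := (ev π Z).ker

instance : AddCommGroup (Delta π Z) := inferInstanceAs (AddCommGroup (ev π Z).ker)

instance : TopologicalSpace (Delta π Z) := inferInstanceAs (TopologicalSpace (ev π Z).ker)

variable (π Z) in
/-- The inclusion of `Δ`. -/
def Delta.inc : Delta π Z →+ FreeMod π Z := (ev π Z).ker.subtype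

variable {G : Type*} [Group G] [MulAction G Z] [ContinuousConstSMul G Z]

/-- The action of `G` on `ℤ_π⟦Z⟧` induced by an action on `Z`. -/
instance : SMul G (FreeMod π Z) where
  smul g μ := AddMonoidHom.mk'
    (fun f => μ (f.comap ⟨fun z => g • z, continuous_const_smul g⟩))
    (fun f f' => by rw [← map_add]; rfl)

theorem FreeMod.smul_apply (g : G) (μ : FreeMod π Z) (f : LocallyConstant Z ℤ) :
    (g • μ) f = μ (f.comap ⟨fun z => g • z, continuous_const_smul g⟩) := rfl

instance : DistribMulAction G (FreeMod π Z) where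
  one_smul μ := FreeMod.ext fun f => by
    rw [FreeMod.smul_apply]; congr 1; ext z; simp
  mul_smul g h μ := FreeMod.ext fun f => by
    simp only [FreeMod.smul_apply]; congr 1; ext z; simp [mul_smul]
  smul_zero g := FreeMod.ext fun f => rfl
  smul_add g μ ν := FreeMod.ext fun f => rfl

instance : ContinuousConstSMul G (FreeMod π Z) where
  continuous_const_smul g := by
    refine continuous_induced_rng.2 (continuous_pi fun f => ?_)
    exact (continuous_apply (f.comap ⟨fun z => g • z, continuous_const_smul g⟩)).comp
      continuous_induced_dom

theorem FreeMod.smul_basis (g : G) (z : Z) :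
    g • FreeMod.basis π z = FreeMod.basis π (g • z) := rfl

theorem ev_smul (g : G) (μ : FreeMod π Z) : ev π Z (g • μ) = ev π Z μ := rfl

/-- `Δ` is a `G`-submodule of `ℤ_π⟦Z⟧`. -/
instance : SMul G (Delta π Z) where
  smul g μ := ⟨g • Delta.inc π Z μ, μ.2⟩

theorem Delta.inc_smul (g : G) (μ : Delta π Z) :
    Delta.inc π Z (g • μ) = g • Delta.inc π Z μ := rfl

instance : DistribMulAction G (Delta π Z) where
  one_smul μ := Subtype.ext (one_smul G (Delta.inc π Z μ))
  mul_smul g h μ := Subtype.ext (mul_smul g h (Delta.inc π Z μ))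
  smul_zero g := Subtype.ext (smul_zero g)
  smul_add g μ ν := Subtype.ext (smul_add g (Delta.inc π Z μ) (Delta.inc π Z ν))

instance : ContinuousConstSMul G (Delta π Z) where
  continuous_const_smul g :=
    Continuous.subtype_mk ((continuous_const_smul g).comp continuous_subtype_val) _

end Free

/-! ## Families of subgroups, and relative cohomology -/

/-- A family `𝒮 = {S_x}` of subgroups of `G` continuously indexed by `X`: the set of pairs
`(g, x)` with `g ∈ S_x` is closed in `G × X`. -/
structure SubgroupFamily (G X : Type u) [Group G] [TopologicalSpace G] [TopologicalSpace X] where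
  sub : X → Subgroup G
  isClosed : IsClosed {gx : G × X | gx.1 ∈ sub gx.2}

section Pair

variable {G X : Type u} [Group G] [TopologicalSpace G] [IsTopologicalGroup G] [TopologicalSpace X]
variable (𝒮 : SubgroupFamily G X)

namespace SubgroupFamily

/-- The space `𝒮 ⊆ G × X` of pairs `(s, x)` with `s ∈ S_x`. -/
abbrev Total : Type u := {gx : G × X // gx.1 ∈ 𝒮.sub gx.2}

/-- The equivalence relation on `G × X` identifying `(g, x)` and `(h, x)` if `g S_x = h S_x`. -/
def cosetSetoid : Setoid (G × X) where
  r a b := a.2 = b.2 ∧ a.1⁻¹ * b.1 ∈ 𝒮.sub a.2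
  iseqv :=
    { refl := fun a => by simp
      symm := by
        rintro ⟨a, x⟩ ⟨b, y⟩ ⟨h, h'⟩
        obtain rfl : x = y := h
        exact ⟨rfl, by simpa using (𝒮.sub x).inv_mem h'⟩
      trans := by
        rintro ⟨a, x⟩ ⟨b, y⟩ ⟨c, z⟩ ⟨h, h'⟩ ⟨k, k'⟩
        obtain rfl : x = y := h
        obtain rfl : x = z := k
        exact ⟨rfl, by simpa [mul_assoc] using (𝒮.sub x).mul_mem h' k'⟩ }

/-- The space `G/𝒮 = ⨆ G/S_x`, with the quotient topology from `G × X`. -/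
def CosetSpace : Type u := Quotient 𝒮.cosetSetoid

instance : TopologicalSpace 𝒮.CosetSpace :=
  inferInstanceAs (TopologicalSpace (Quotient 𝒮.cosetSetoid))

/-- The coset `g S_x`. -/
def coset (g : G) (x : X) : 𝒮.CosetSpace := Quotient.mk 𝒮.cosetSetoid (g, x)

theorem continuous_coset : Continuous fun gx : G × X => 𝒮.coset gx.1 gx.2 :=
  continuous_quotient_mk'

theorem coset_eq_of_mem {s : G} {x : X} (hs : s ∈ 𝒮.sub x) (g : G) :
    𝒮.coset (g * s) x = 𝒮.coset g x :=
  Quotient.sound ⟨rfl, by simpa using hs⟩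

/-- The action of `G` on `G/𝒮` by left multiplication. -/
instance : SMul G 𝒮.CosetSpace where
  smul g := Quotient.map (fun a : G × X => (g * a.1, a.2)) (by
    rintro ⟨a, x⟩ ⟨b, y⟩ ⟨h, h'⟩
    exact ⟨h, by simpa [mul_assoc] using h'⟩)

@[simp] theorem smul_coset (g h : G) (x : X) : g • 𝒮.coset h x = 𝒮.coset (g * h) x := rfl

instance : MulAction G 𝒮.CosetSpace where
  one_smul z := by
    induction z using Quotient.inductionOn with
    | h a => exact congrArg (Quotient.mk _) (Prod.ext (one_mul _) rfl)
  mul_smul g h z := by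
    induction z using Quotient.inductionOn with
    | h a => exact congrArg (Quotient.mk _) (Prod.ext (mul_assoc _ _ _) rfl)

instance : ContinuousConstSMul G 𝒮.CosetSpace where
  continuous_const_smul g :=
    continuous_quot_lift _ (𝒮.continuous_coset.comp
      (by fun_prop : Continuous fun a : G × X => (g * a.1, a.2)))

end SubgroupFamily

variable (π : Set Nat.Primes)
variable (A : Type u) [AddCommGroup A] [DistribMulAction G A] [TopologicalSpace A]
  [DiscreteTopology A] [ContinuousSMul G A]

/-- The `G`-module `Hom(ℤ_π⟦G/𝒮⟧, A)`. -/
abbrev HomFree : Type u := CHom (FreeMod π 𝒮.CosetSpace) A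

/-- The `G`-module `Hom(Δ, A)`, where `Δ` is the kernel of `ℤ_π⟦G/𝒮⟧ → ℤ_π`. -/
abbrev HomDelta : Type u := CHom (Delta π 𝒮.CosetSpace) A

/-- The relative cohomology group `Hⁿ⁺¹(G, 𝒮; A)`.

If `X` is nonempty, the first component is forced to vanish and this is
`Hⁿ⁺¹(G, 𝒮; A) = Hⁿ(G; Hom(Δ, A))`. If `X` is empty, `Δ = 0`, the second component carries no
information and this is the absolute group `Hⁿ⁺¹(G; A)`, the usual convention for the empty
family. -/
def relCohomologySucc (n : ℕ) :
    AddSubgroup (Cohomology G A (n + 1) × Cohomology G (HomDelta 𝒮 π A) n) where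
  carrier := {c | Nonempty X → c.1 = 0}
  zero_mem' := fun _ => rfl
  add_mem' := fun {a b} ha hb hX => by
    change a.1 + b.1 = 0
    rw [ha hX, hb hX, add_zero]
  neg_mem' := fun {a} ha hX => by
    change -a.1 = 0
    rw [ha hX, neg_zero]

/-- `cd_p(G, 𝒮) ≤ n`: the group `Hⁿ⁺¹(G, 𝒮; A)` vanishes for every discrete `p`-primary
`G`-module `A`. -/
def RelCdLE (p : Nat.Primes) (n : ℕ) : Prop :=
  ∀ (A : Type u) [AddCommGroup A] [DistribMulAction G A] [TopologicalSpace A]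
    [DiscreteTopology A] [ContinuousSMul G A],
    (∀ a : A, ∃ k : ℕ, (p : ℕ) ^ k • a = 0) → ∀ c : relCohomologySucc 𝒮 π A n, c = 0

/-! ## Relative extensions -/

/-- A relative extension of `(G, 𝒮)` by the `G`-module `A`: an extension `0 → A → E → G → 1` of
profinite groups inducing the given action of `G` on `A`, with a continuous map `q : 𝒮 → E`
which restricts on each `S_x` to a homomorphism splitting the projection. -/
structure RelExtension where
  E : ProfiniteGrp.{u}
  ext : GroupExtension (Multiplicative A) E G
  continuous_inl : Continuous ext.inl
  continuous_rightHom : Continuous ext.rightHom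
  conj : ∀ (e : E) (a : A), e * ext.inl (Multiplicative.ofAdd a) * e⁻¹ =
    ext.inl (Multiplicative.ofAdd (ext.rightHom e • a))
  q : 𝒮.Total → E
  continuous_q : Continuous q
  q_mul : ∀ (x : X) (s t : G) (hs : s ∈ 𝒮.sub x) (ht : t ∈ 𝒮.sub x),
    q ⟨(s * t, x), (𝒮.sub x).mul_mem hs ht⟩ = q ⟨(s, x), hs⟩ * q ⟨(t, x), ht⟩
  rightHom_q : ∀ s : 𝒮.Total, ext.rightHom (q s) = s.1.1

variable {𝒮 A} in
/-- Equivalence of relative extensions: a continuous equivalence `f` of extensions such that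
`f ∘ q` and `q'` are conjugate through a continuous function `a : X → A`. -/
def RelExtension.Equivalent (R R' : RelExtension 𝒮 A) : Prop :=
  ∃ f : R.ext.Equiv R'.ext, Continuous f ∧ ∃ a : X → A, Continuous a ∧
    ∀ s : 𝒮.Total, R'.q s = R'.ext.inl (Multiplicative.ofAdd (a s.1.2)) * f (R.q s) *
      (R'.ext.inl (Multiplicative.ofAdd (a s.1.2)))⁻¹

end Pair

/-! ### The extension defined by a cocycle -/

section CocycleExt

variable {G A : Type u} [Group G] [TopologicalSpace G] [AddCommGroup A] [DistribMulAction G A]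

theorem cochainD_two (f : (Fin 2 → G) → A) (g h k : G) :
    cochainD G A 2 f ![g, h, k] =
      g • f ![h, k] - f ![g * h, k] + f ![g, h * k] - f ![g, h] := by
  have h0 : Fin.contractNth (0 : Fin 3) (· * ·) ![g, h, k] = ![g * h, k] := by
    ext i; fin_cases i <;> rfl
  have h1 : Fin.contractNth (1 : Fin 3) (· * ·) ![g, h, k] = ![g, h * k] := by
    ext i; fin_cases i <;> rfl
  have h2 : Fin.contractNth (2 : Fin 3) (· * ·) ![g, h, k] = ![g, h] := by
    ext i; fin_cases i <;> rfl
  have h3 : (fun i : Fin 2 => (![g, h, k] : Fin 3 → G) i.succ) = ![h, k] := by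
    ext i; fin_cases i <;> rfl
  change g • f (fun i : Fin 2 => (![g, h, k] : Fin 3 → G) i.succ) + _ = _
  rw [h3]
  simp [Fin.sum_univ_three, h0, h1, h2]
  abel

theorem cochainD_one (f : (Fin 1 → G) → A) (g h : G) :
    cochainD G A 1 f ![g, h] = g • f ![h] - f ![g * h] + f ![g] := by
  have h0 : Fin.contractNth (0 : Fin 2) (· * ·) ![g, h] = ![g * h] := by
    ext i; fin_cases i; rfl
  have h1 : Fin.contractNth (1 : Fin 2) (· * ·) ![g, h] = ![g] := by
    ext i; fin_cases i; rfl
  have h3 : (fun i : Fin 1 => (![g, h] : Fin 2 → G) i.succ) = ![h] := by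
    ext i; fin_cases i; rfl
  change g • f (fun i : Fin 1 => (![g, h] : Fin 2 → G) i.succ) + _ = _
  rw [h3]
  simp [Fin.sum_univ_two, h0, h1]
  abel

theorem cocycle_two (ζ : cocycles G A 2) (g h k : G) :
    g • ζ.1 ![h, k] + ζ.1 ![g, h * k] = ζ.1 ![g, h] + ζ.1 ![g * h, k] := by
  have := congrFun (show cochainD G A 2 ζ.1 = 0 from ζ.2.2) ![g, h, k]
  rw [cochainD_two, Pi.zero_apply] at this
  rw [← sub_eq_zero, ← this]
  abel

/-- The extension of `G` by `A` defined by a cocycle `ζ`, with underlying set `A × G`. -/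
@[ext] structure CocycleExt (ζ : cocycles G A 2) : Type u where
  fst : A
  snd : G

namespace CocycleExt

variable {ζ : cocycles G A 2}

/-- `(a₁, g₁) ⋆ (a₂, g₂) = (a₁ + g₁ a₂ + ζ(g₁, g₂), g₁ g₂)`. -/
instance : Mul (CocycleExt ζ) where
  mul e f := ⟨e.fst + e.snd • f.fst + ζ.1 ![e.snd, f.snd], e.snd * f.snd⟩

instance : One (CocycleExt ζ) where
  one := ⟨-ζ.1 ![1, 1], 1⟩

instance : Inv (CocycleExt ζ) where
  inv e := ⟨-(e.snd⁻¹ • e.fst) - ζ.1 ![e.snd⁻¹, e.snd] - ζ.1 ![1, 1], e.snd⁻¹⟩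

@[simp] theorem fst_mul (e f : CocycleExt ζ) :
    (e * f).fst = e.fst + e.snd • f.fst + ζ.1 ![e.snd, f.snd] := rfl
@[simp] theorem snd_mul (e f : CocycleExt ζ) : (e * f).snd = e.snd * f.snd := rfl
@[simp] theorem fst_one : (1 : CocycleExt ζ).fst = -ζ.1 ![1, 1] := rfl
@[simp] theorem snd_one : (1 : CocycleExt ζ).snd = 1 := rfl
@[simp] theorem fst_inv (e : CocycleExt ζ) :
    (e⁻¹).fst = -(e.snd⁻¹ • e.fst) - ζ.1 ![e.snd⁻¹, e.snd] - ζ.1 ![1, 1] := rfl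
@[simp] theorem snd_inv (e : CocycleExt ζ) : (e⁻¹).snd = e.snd⁻¹ := rfl

theorem cocycle_one_left (ζ : cocycles G A 2) (g : G) : ζ.1 ![1, g] = ζ.1 ![1, 1] := by
  have := cocycle_two ζ 1 1 g
  simpa using this

theorem cocycle_one_right (ζ : cocycles G A 2) (g : G) : ζ.1 ![g, 1] = g • ζ.1 ![1, 1] := by
  have := cocycle_two ζ g 1 1
  simpa using this.symm

instance : Group (CocycleExt ζ) :=
  Group.ofLeftAxioms
    (fun e f k => by
      ext
      · have := cocycle_two ζ e.snd f.snd k.snd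
        simp only [fst_mul, snd_mul, smul_add, mul_smul]
        rw [← sub_eq_zero] at this ⊢
        rw [← neg_eq_zero, ← this]
        abel
      · simp [mul_assoc])
    (fun e => by
      ext
      · simp [cocycle_one_left]
      · simp)
    (fun e => by
      ext
      · simp only [fst_mul, fst_inv, snd_inv, fst_one]
        abel
      · simp)

/-- The underlying set is `A × G`. -/
def toProd (ζ : cocycles G A 2) : CocycleExt ζ ≃ A × G where
  toFun e := (e.fst, e.snd)
  invFun e := ⟨e.1, e.2⟩
  left_inv _ := rfl
  right_inv _ := rfl

variable [TopologicalSpace A]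

/-- The product topology. -/
instance : TopologicalSpace (CocycleExt ζ) :=
  TopologicalSpace.induced (toProd ζ) inferInstance

/-- The identification with `A × G` as a homeomorphism. -/
def homeoProd (ζ : cocycles G A 2) : CocycleExt ζ ≃ₜ A × G :=
  (toProd ζ).toHomeomorphOfIsInducing ⟨rfl⟩

theorem continuous_fst : Continuous (CocycleExt.fst : CocycleExt ζ → A) :=
  _root_.continuous_fst.comp (homeoProd ζ).continuous

theorem continuous_snd : Continuous (CocycleExt.snd : CocycleExt ζ → G) :=
  _root_.continuous_snd.comp (homeoProd ζ).continuous

theorem continuous_mk {Y : Type*} [TopologicalSpace Y] {a : Y → A} {g : Y → G}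
    (ha : Continuous a) (hg : Continuous g) :
    Continuous fun y => (⟨a y, g y⟩ : CocycleExt ζ) :=
  (homeoProd ζ).symm.continuous.comp (ha.prodMk hg)

variable [DiscreteTopology A]

theorem continuous_cocycle {Y : Type*} [TopologicalSpace Y] {g h : Y → G}
    (hg : Continuous g) (hh : Continuous h) : Continuous fun y => ζ.1 ![g y, h y] :=
  (show IsLocallyConstant ζ.1 from ζ.2.1).continuous.comp (continuous_pi fun i => by
    fin_cases i
    · exact hg
    · exact hh)

variable [IsTopologicalGroup G] [ContinuousSMul G A]

instance : IsTopologicalGroup (CocycleExt ζ) where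
  continuous_mul := by
    have h1 := (continuous_fst (ζ := ζ)).comp (_root_.continuous_fst (Y := CocycleExt ζ))
    have h2 := (continuous_fst (ζ := ζ)).comp (_root_.continuous_snd (X := CocycleExt ζ))
    have h3 := (continuous_snd (ζ := ζ)).comp (_root_.continuous_fst (Y := CocycleExt ζ))
    have h4 := (continuous_snd (ζ := ζ)).comp (_root_.continuous_snd (X := CocycleExt ζ))
    exact continuous_mk ((h1.add (h3.smul h2)).add (continuous_cocycle h3 h4)) (h3.mul h4)
  continuous_inv := by
    have h1 := continuous_fst (ζ := ζ)
    have h2 := continuous_snd (ζ := ζ)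
    exact continuous_mk (((h2.inv.smul h1).neg.sub (continuous_cocycle h2.inv h2)).sub
      continuous_const) h2.inv

instance [CompactSpace G] [Finite A] : CompactSpace (CocycleExt ζ) :=
  (homeoProd ζ).symm.compactSpace

instance [TotallyDisconnectedSpace G] : TotallyDisconnectedSpace (CocycleExt ζ) :=
  (homeoProd ζ).symm.totallyDisconnectedSpace

end CocycleExt

end CocycleExt

section Construction

variable {G X : Type u} [Group G] [TopologicalSpace G] [IsTopologicalGroup G] [CompactSpace G]
  [TotallyDisconnectedSpace G] [TopologicalSpace X] {𝒮 : SubgroupFamily G X}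
  (π : Set Nat.Primes)
  {A : Type u} [AddCommGroup A] [DistribMulAction G A] [TopologicalSpace A]
  [DiscreteTopology A] [ContinuousSMul G A]

/-- The relation `d²η = ev^* ζ` between `η ∈ C¹(𝒮; A)` and `ζ ∈ C²(G; A)`, where `ev^* ζ` takes
the constant value `ζ(g, h)` on the basis `G/𝒮` of `ℤ_π⟦G/𝒮⟧`. -/
def Bounds (η : cochains G (HomFree 𝒮 π A) 1) (ζ : cocycles G A 2) : Prop :=
  ∀ (g : Fin 2 → G) (z : 𝒮.CosetSpace),
    cochainD G (HomFree 𝒮 π A) 1 η.1 g (FreeMod.basis π z) = ζ.1 g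

variable {π}

theorem Bounds.eq {η : cochains G (HomFree 𝒮 π A) 1} {ζ : cocycles G A 2} (h : Bounds π η ζ)
    {x : X} {s t : G} (hs : s ∈ 𝒮.sub x) :
    s • η.1 ![t] (FreeMod.basis π (𝒮.coset 1 x)) + η.1 ![s] (FreeMod.basis π (𝒮.coset 1 x)) =
      η.1 ![s * t] (FreeMod.basis π (𝒮.coset 1 x)) + ζ.1 ![s, t] := by
  have h1 := h ![s, t] (𝒮.coset 1 x)
  rw [cochainD_one, sub_eq_add_neg] at h1
  have h2 : s⁻¹ • FreeMod.basis π (𝒮.coset 1 x) = FreeMod.basis π (𝒮.coset 1 x) := by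
    rw [FreeMod.smul_basis, SubgroupFamily.smul_coset, mul_one]
    congr 1
    simpa using 𝒮.coset_eq_of_mem ((𝒮.sub x).inv_mem hs) 1
  simp only [CHom.add_apply, CHom.neg_apply, CHom.smul_apply, h2] at h1
  rw [← h1]
  abel

/-- The relative extension `(E_ζ, q)` with `q(s, x) = (-η(s)(1 S_x), s)`, attached to cochains
with `d²η = ev^* ζ`. -/
def RelExtension.ofCochains [Finite A] (η : cochains G (HomFree 𝒮 π A) 1) (ζ : cocycles G A 2)
    (h : Bounds π η ζ) : RelExtension 𝒮 A where
  E := ProfiniteGrp.of (CocycleExt ζ)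
  ext :=
    { inl :=
        { toFun := fun a => (⟨a.toAdd - ζ.1 ![1, 1], 1⟩ : CocycleExt ζ)
          map_one' := by
            refine CocycleExt.ext ?_ rfl
            change (0 : A) - _ = - _
            simp
          map_mul' := fun a b => by
            refine CocycleExt.ext ?_ (mul_one _).symm
            change a.toAdd + b.toAdd - _ = a.toAdd - _ + (1 : G) • (b.toAdd - _) + _
            rw [one_smul]
            abel }
      rightHom :=
        { toFun := fun e => CocycleExt.snd e
          map_one' := rfl
          map_mul' := fun _ _ => rfl }
      inl_injective := fun a b hab =>
        sub_left_injective (G := A) (congrArg (CocycleExt.fst (ζ := ζ)) hab)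
      range_inl_eq_ker_rightHom := by
        ext e
        constructor
        · rintro ⟨a, rfl⟩
          rfl
        · intro he
          refine ⟨Multiplicative.ofAdd (CocycleExt.fst (ζ := ζ) e + ζ.1 ![1, 1]), ?_⟩
          exact CocycleExt.ext (add_sub_cancel_right _ _)
            (show CocycleExt.snd (ζ := ζ) e = 1 from he).symm
      rightHom_surjective := fun g => ⟨(⟨0, g⟩ : CocycleExt ζ), rfl⟩ }
  continuous_inl := continuous_of_discreteTopology
  continuous_rightHom := CocycleExt.continuous_snd (ζ := ζ)
  conj := fun e a => by
    rw [mul_inv_eq_iff_eq_mul]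
    refine CocycleExt.ext (ζ := ζ) ?_ ?_
    · change CocycleExt.fst (ζ := ζ) e + CocycleExt.snd (ζ := ζ) e • (a - ζ.1 ![1, 1]) +
          ζ.1 ![CocycleExt.snd (ζ := ζ) e, 1] =
        (CocycleExt.snd (ζ := ζ) e • a - ζ.1 ![1, 1]) + (1 : G) • CocycleExt.fst (ζ := ζ) e +
          ζ.1 ![1, CocycleExt.snd (ζ := ζ) e]
      rw [CocycleExt.cocycle_one_left ζ (CocycleExt.snd (ζ := ζ) e),
        CocycleExt.cocycle_one_right ζ (CocycleExt.snd (ζ := ζ) e), smul_sub,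
        one_smul G (CocycleExt.fst (ζ := ζ) e)]
      abel
    · change CocycleExt.snd (ζ := ζ) e * 1 = 1 * CocycleExt.snd (ζ := ζ) e
      simp
  q := fun s => (⟨-(η.1 ![s.1.1] (FreeMod.basis π (𝒮.coset 1 s.1.2))), s.1.1⟩ : CocycleExt ζ)
  continuous_q := by
    refine CocycleExt.continuous_mk ?_ (by fun_prop)
    refine Continuous.neg ?_
    rw [continuous_iff_continuousAt]
    intro s₀
    have hη : IsLocallyConstant fun s : 𝒮.Total => η.1 ![s.1.1] :=
      (show IsLocallyConstant η.1 from η.2).comp_continuous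
        (continuous_pi fun i => by
          fin_cases i
          exact (by fun_prop : Continuous fun s : 𝒮.Total => s.1.1))
    have hc : Continuous fun s : 𝒮.Total =>
        η.1 ![s₀.1.1] (FreeMod.basis π (𝒮.coset 1 s.1.2)) :=
      (map_continuous (η.1 ![s₀.1.1])).comp (FreeMod.continuous_basis.comp
        (𝒮.continuous_coset.comp (by fun_prop : Continuous fun s : 𝒮.Total => ((1 : G), s.1.2))))
    refine hc.continuousAt.congr ?_
    filter_upwards [hη.eventually_eq s₀] with s hs
    rw [hs]
  q_mul := fun x s t hs ht => by
    refine CocycleExt.ext (ζ := ζ) ?_ rfl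
    change -(η.1 ![s * t] _) = -(η.1 ![s] _) + s • -(η.1 ![t] _) + ζ.1 ![s, t]
    have := h.eq (t := t) hs
    rw [smul_neg]
    rw [← sub_eq_zero] at this ⊢
    rw [← this]
    abel
  rightHom_q := fun _ => rfl

variable (π) in
/-- The relative extension `R` represents the class `c ∈ H²(G, 𝒮; A)`: there are a cocycle
`ξ ∈ C²(G, 𝒮; A)` in the class `c`, a cochain `η ∈ C¹(𝒮; A)` with `inc^* η = ξ`, and
`ζ ∈ C²(G; A)` with `d²η = ev^* ζ`, such that `R` is equivalent to the relative extension
`(E_ζ, q)` constructed from these. (If `X` is empty, then `c` is the class of `ζ`.) -/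
def RelExtension.Represents [Finite A] (R : RelExtension 𝒮 A)
    (c : relCohomologySucc 𝒮 π A 1) : Prop :=
  ∃ (ξ : cocycles G (HomDelta 𝒮 π A) 1) (η : cochains G (HomFree 𝒮 π A) 1) (ζ : cocycles G A 2)
    (h : Bounds π η ζ),
    (∀ (g : Fin 1 → G) (μ : Delta π 𝒮.CosetSpace), ξ.1 g μ = η.1 g (Delta.inc π _ μ)) ∧
    c.1.2 = QuotientAddGroup.mk ξ ∧
    (IsEmpty X → c.1.1 = QuotientAddGroup.mk ζ) ∧
    R.Equivalent (RelExtension.ofCochains η ζ h)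

end Construction

/-! ## Lifting problems -/

section Lifting

variable {G X : Type u} [Group G] [TopologicalSpace G] [IsTopologicalGroup G] [TopologicalSpace X]

/-- A pro-`𝒞` lifting problem of `G` relative to `𝒮`. -/
structure LiftingProblem (C : FiniteGroupVariety) (𝒮 : SubgroupFamily G X) where
  H : ProfiniteGrp.{u}
  Q : ProfiniteGrp.{u}
  isPro_H : C.IsPro H
  isPro_Q : C.IsPro Q
  α : H →* Q
  continuous_α : Continuous α
  surjective_α : Function.Surjective α
  φ : G →* Q
  continuous_φ : Continuous φ
  σ : 𝒮.Total → H
  continuous_σ : Continuous σ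
  σ_mul : ∀ (x : X) (s t : G) (hs : s ∈ 𝒮.sub x) (ht : t ∈ 𝒮.sub x),
    σ ⟨(s * t, x), (𝒮.sub x).mul_mem hs ht⟩ = σ ⟨(s, x), hs⟩ * σ ⟨(t, x), ht⟩
  α_σ : ∀ s : 𝒮.Total, α (σ s) = φ s.1.1

namespace LiftingProblem

variable {C : FiniteGroupVariety} {𝒮 : SubgroupFamily G X} (P : LiftingProblem C 𝒮)

/-- The lifting problem has a solution: a continuous homomorphism `φ' : G → H` lifting `φ`, and a
continuous `c : X → ker α` with `c(x) φ'(s) c(x)⁻¹ = σ(s, x)` for all `s ∈ S_x`. -/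
def HasSolution : Prop :=
  ∃ (φ' : G →* P.H) (c : X → P.α.ker), Continuous φ' ∧ Continuous c ∧
    (∀ g, P.α (φ' g) = P.φ g) ∧
    ∀ s : 𝒮.Total, (c s.1.2 : P.H) * φ' s.1.1 * (c s.1.2 : P.H)⁻¹ = P.σ s

/-- The kernel of the lifting problem is finite and abelian. -/
class FiniteAbelianKernel : Prop where
  finite : Finite P.α.ker
  comm : ∀ a b : P.α.ker, a * b = b * a

/-- The kernel of the lifting problem, written additively. -/
def KerModule : Type u := Additive P.α.ker

/-- The identification of the kernel module with the kernel. -/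
def KerModule.val {P : LiftingProblem C 𝒮} (a : P.KerModule) : P.H :=
  (Additive.toMul (α := P.α.ker) a : P.α.ker)

theorem KerModule.val_injective {P : LiftingProblem C 𝒮} :
    Function.Injective (KerModule.val (P := P)) :=
  fun _ _ h => Subtype.val_injective h

theorem KerModule.α_val {P : LiftingProblem C 𝒮} (a : P.KerModule) : P.α a.val = 1 :=
  (Additive.toMul (α := P.α.ker) a).2

/-- The subspace topology. -/
instance : TopologicalSpace P.KerModule := inferInstanceAs (TopologicalSpace P.α.ker)

variable [hP : P.FiniteAbelianKernel]

instance : AddCommGroup P.KerModule :=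
  { (inferInstance : AddGroup (Additive P.α.ker)) with
    add_comm := fun a b => hP.comm a b }

theorem KerModule.val_add (a b : P.KerModule) : (a + b).val = a.val * b.val := rfl

instance : Finite P.KerModule := hP.finite

instance : DiscreteTopology P.KerModule :=
  have : Finite P.α.ker := hP.finite
  inferInstanceAs (DiscreteTopology P.α.ker)

/-- The action of `Q` on the abelian kernel: `α(h)` acts by conjugation by `h`. -/
def actQ : P.Q →* MulAut P.α.ker :=
  P.α.liftOfSurjective P.surjective_α ⟨MulAut.conjNormal, fun k hk => by
    ext a
    have := congrArg Subtype.val (hP.comm ⟨k, hk⟩ a)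
    simpa [MulAut.conjNormal_apply, mul_inv_eq_iff_eq_mul] using this⟩

theorem actQ_α (h : P.H) (a : P.α.ker) : (P.actQ (P.α h) a : P.H) = h * a * h⁻¹ := by
  have : P.actQ (P.α h) = MulAut.conjNormal h :=
    MonoidHom.liftOfRightInverse_comp_apply _ _ _ _ h
  rw [this, MulAut.conjNormal_apply]

/-- The kernel as a `G`-module, via `φ` and the conjugation action of `Q`. -/
instance : DistribMulAction G P.KerModule where
  smul g a := Additive.ofMul (P.actQ (P.φ g) (Additive.toMul (α := P.α.ker) a))
  one_smul a := by
    change Additive.ofMul (P.actQ (P.φ 1) _) = _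
    rw [map_one, map_one]; rfl
  mul_smul g h a := by
    change Additive.ofMul (P.actQ (P.φ (g * h)) _) = _
    rw [map_mul, map_mul]; rfl
  smul_zero g := map_one (P.actQ (P.φ g))
  smul_add g a b := map_mul (P.actQ (P.φ g)) _ _

theorem KerModule.val_smul {g : G} {h : P.H} (hgh : P.φ g = P.α h) (a : P.KerModule) :
    (g • a).val = h * a.val * h⁻¹ := by
  change (P.actQ (P.φ g) _ : P.H) = _
  rw [hgh, actQ_α]; rfl

instance : ContinuousSMul G P.KerModule where
  continuous_smul := by
    rw [continuous_prod_of_discrete_right]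
    intro a
    have hq : IsQuotientMap P.α :=
      (P.continuous_α.isClosedMap).isQuotientMap P.continuous_α P.surjective_α
    have h1 : Continuous fun q : P.Q => P.actQ q (Additive.toMul (α := P.α.ker) a) := by
      rw [hq.continuous_iff]
      refine continuous_induced_rng.2 ?_
      have : (Subtype.val ∘ ((fun q : P.Q => P.actQ q (Additive.toMul (α := P.α.ker) a)) ∘ P.α)) =
          fun h => h * a.val * h⁻¹ := funext fun h => P.actQ_α h _
      rw [this]
      fun_prop
    exact h1.comp P.continuous_φ

/-! ### The pullback relative extension -/

/-- The group `E = {(g, h) ∈ G × H | φ(g) = α(h)}`. -/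
def pullbackGroup (P : LiftingProblem C 𝒮) : Subgroup (G × P.H) :=
  (P.φ.comp (MonoidHom.fst G P.H)).eqLocus (P.α.comp (MonoidHom.snd G P.H))

theorem mem_pullbackGroup (P : LiftingProblem C 𝒮) {x : G × P.H} :
    x ∈ P.pullbackGroup ↔ P.φ x.1 = P.α x.2 := Iff.rfl

instance [CompactSpace G] (P : LiftingProblem C 𝒮) : CompactSpace P.pullbackGroup :=
  isCompact_iff_compactSpace.1 (IsClosed.isCompact
    (isClosed_eq (P.continuous_φ.comp continuous_fst) (P.continuous_α.comp continuous_snd)))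

/-- The pullback relative extension `(E, q)` with `q(s, x) = (s, σ(s, x))`. -/
def pullback [CompactSpace G] [TotallyDisconnectedSpace G] : RelExtension 𝒮 P.KerModule where
  E := ProfiniteGrp.of P.pullbackGroup
  ext :=
    { inl :=
        { toFun := fun a => (⟨(1, KerModule.val a.toAdd), by
            rw [mem_pullbackGroup, KerModule.α_val, map_one]⟩ : P.pullbackGroup)
          map_one' := rfl
          map_mul' := fun a b => Subtype.ext (Prod.ext (mul_one _).symm rfl) }
      rightHom := (MonoidHom.fst G P.H).comp P.pullbackGroup.subtype
      inl_injective := fun a b hab =>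
        KerModule.val_injective
          (congrArg (fun e : P.pullbackGroup => (e : G × P.H).2) hab)
      range_inl_eq_ker_rightHom := by
        ext e
        constructor
        · rintro ⟨a, rfl⟩
          rfl
        · intro he
          have he' : (Subtype.val (p := (· ∈ P.pullbackGroup)) e).1 = 1 := he
          have h2 := P.mem_pullbackGroup.1 (Subtype.prop (p := (· ∈ P.pullbackGroup)) e)
          rw [he', map_one] at h2
          exact ⟨Multiplicative.ofAdd (Additive.ofMul
            (⟨(Subtype.val (p := (· ∈ P.pullbackGroup)) e).2, h2.symm⟩ : P.α.ker)),
            Subtype.ext (Prod.ext he'.symm rfl)⟩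
      rightHom_surjective := fun g => by
        obtain ⟨h, hh⟩ := P.surjective_α (P.φ g)
        exact ⟨(⟨(g, h), hh.symm⟩ : P.pullbackGroup), rfl⟩ }
  continuous_inl := continuous_of_discreteTopology
  continuous_rightHom := continuous_fst.comp continuous_subtype_val
  conj := fun e a => by
    refine Subtype.ext (Prod.ext ?_ ?_)
    · change (Subtype.val (p := (· ∈ P.pullbackGroup)) e).1 * 1 *
        (Subtype.val (p := (· ∈ P.pullbackGroup)) e).1⁻¹ = 1
      simp
    · exact (KerModule.val_smul P
        (P.mem_pullbackGroup.1 (Subtype.prop (p := (· ∈ P.pullbackGroup)) e)) a).symm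
  q := fun s => (⟨(s.1.1, P.σ s), (P.α_σ s).symm⟩ : P.pullbackGroup)
  continuous_q := Continuous.subtype_mk
    ((continuous_fst.comp continuous_subtype_val).prodMk P.continuous_σ) _
  q_mul := fun x s t hs ht => Subtype.ext (Prod.ext rfl (P.σ_mul x s t hs ht))
  rightHom_q := fun _ => rfl

end LiftingProblem

end Lifting

end

end RelCoh

open RelCoh

/-!
The relative extensions of `(G, 𝒮)` by a finite module `A`, up to equivalence, are pairs `(η, ζ)` of
cochains with `dη = ev^* ζ`, up to coboundaries. Both halves of this correspondence rest on the
identification of `Hom(ℤ_π⟦G/𝒮⟧, A)` with the continuous functions `G/𝒮 → A`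
(`FreeMod.exists_chom`, `FreeMod.chom_ext`), valid for discrete `A` whose elements have orders
involving only primes in `π`.

Every relative extension `(E, q)` comes from cochains
(`RelExtension.exists_equivalent_ofCochains`): the subgroups `q_x(S_x)` of `E` meet `A` trivially,
so `E / q_x(S_x) → G / S_x` is an `A`-torsor, and these torsors have a trivialization that is
continuous in `x` (`exists_continuous_retraction`). The failure of the trivialization to be
`G`-equivariant is `η`. Conversely, a splitting of the extension given by `(η, ζ)` consists of
functions `b : G → A` and `a : X → A` satisfying the identities of `IsTrivializedBy`. Such
functions exist if and only if the class of `(η, ζ)` vanishes: this is an explicit form of Shapiro's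
lemma (`IsTrivializedBy.mem_coboundaries`, `exists_isTrivializedBy`). As an equivalence between the
extensions given by two pairs is a trivialization of their difference, an extension represents
exactly one class, and this class is zero if and only if the extension splits. For the pullback
extension of a lifting problem, splittings are solutions.

If `cd_p(G, 𝒮) ≤ 1` for the primes `p` in `π(𝒞)`, then `H²(G, 𝒮; A) = 0` for every finite `A` whose
order involves only such primes, by reduction to the `p`-primary parts of `A`
(`eq_zero_of_relCdLE`). Conversely, a class in `H²(G, 𝒮; A)` with `A` discrete and `p`-primary is
given by cochains with values in a finite submodule. If `𝒞` is closed under extensions, then the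
extension they define is pro-`𝒞`, and lifting the identity of `G` to it makes the class vanish
(`relCdLE_one_of_hasSolution`).
-/

namespace RelCoh

noncomputable section

/-! ### Locally constant choices and equivariant functions -/

/-- On a profinite space, data which can be chosen constant near each point can be chosen
locally constant. -/
theorem exists_isLocallyConstant_choice {X D : Type*} [TopologicalSpace X] [CompactSpace X]
    [T2Space X] [TotallyDisconnectedSpace X] {P : X → D → Prop}
    (h : ∀ x, ∃ d, ∀ᶠ y in 𝓝 x, P y d) :
    ∃ f : X → D, IsLocallyConstant f ∧ ∀ x, P x (f x) := by
  classical
  rcases isEmpty_or_nonempty X with hX | ⟨⟨x₀⟩⟩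
  · exact ⟨fun x => hX.elim x, fun s => by
      rw [Set.eq_empty_of_isEmpty ((fun x => hX.elim x) ⁻¹' s)]; exact isOpen_empty,
      fun x => hX.elim x⟩
  obtain ⟨d₀, -⟩ := h x₀
  have key : ∃ K : Set X, IsClopen K ∧ Set.univ ⊆ K ∧ ∃ f : X → D, IsLocallyConstant f ∧
      ∀ x ∈ K, P x (f x) := by
    refine isCompact_univ.induction_on
      (p := fun s => ∃ K : Set X, IsClopen K ∧ s ⊆ K ∧ ∃ f : X → D, IsLocallyConstant f ∧
        ∀ x ∈ K, P x (f x)) ?_ ?_ ?_ ?_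
    · exact ⟨∅, isClopen_empty, subset_rfl, fun _ => d₀, IsLocallyConstant.const d₀,
        fun x hx => hx.elim⟩
    · rintro s t hst ⟨K, hK, htK, hf⟩
      exact ⟨K, hK, hst.trans htK, hf⟩
    · rintro s t ⟨K, hK, hsK, f, hf, hfP⟩ ⟨L, hL, htL, g, hg, hgP⟩
      refine ⟨K ∪ L, hK.union hL, Set.union_subset_union hsK htL, K.piecewise f g, ?_, ?_⟩
      · rw [IsLocallyConstant.iff_eventually_eq]
        intro x
        by_cases hx : x ∈ K
        · filter_upwards [hf.eventually_eq x, hK.isOpen.mem_nhds hx] with y hy hyK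
          simp [hx, hyK, hy]
        · filter_upwards [hg.eventually_eq x, hK.compl.isOpen.mem_nhds hx] with y hy hyK
          have hyK' : y ∉ K := hyK
          simp [hx, hyK', hy]
      · intro x hx
        by_cases hxK : x ∈ K
        · simpa [hxK] using hfP x hxK
        · simpa [hxK] using hgP x (hx.resolve_left hxK)
    · intro x _
      obtain ⟨d, hd⟩ := h x
      obtain ⟨V, ⟨hxV, hV⟩, hVP⟩ := (nhds_basis_clopen x).mem_iff.1 hd
      exact ⟨V, mem_nhdsWithin_of_mem_nhds (hV.isOpen.mem_nhds hxV), V, hV, subset_rfl,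
        fun _ => d, IsLocallyConstant.const d, fun y hy => hVP hy⟩
  obtain ⟨K, -, hK, f, hf, hfP⟩ := key
  exact ⟨f, hf, fun x => hfP x (hK (Set.mem_univ x))⟩

theorem continuous_uncurry_of_isLocallyConstant {X Y Z : Type*} [TopologicalSpace X]
    [TopologicalSpace Y] [TopologicalSpace Z] {f : X → Y → Z} (hf : IsLocallyConstant f)
    (hc : ∀ x, Continuous (f x)) : Continuous fun p : X × Y => f p.1 p.2 := by
  rw [continuous_iff_continuousAt]
  rintro ⟨x, y⟩
  refine ContinuousAt.congr (f := fun p : X × Y => f x p.2)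
    (((hc x).comp continuous_snd).continuousAt) ?_
  filter_upwards [continuous_fst.continuousAt.eventually (hf.eventually_eq x)] with p hp
  exact congrFun hp.symm p.2

/-- A continuous function on `X × Y`, with `Y` compact and with discrete values, is locally
constant as a function from `X` to functions on `Y`. -/
theorem isLocallyConstant_curry {X Y Z : Type*} [TopologicalSpace X]
    [TopologicalSpace Y] [CompactSpace Y] [TopologicalSpace Z] [DiscreteTopology Z]
    {f : X → Y → Z} (hf : Continuous fun p : X × Y => f p.1 p.2) : IsLocallyConstant f := by
  rw [IsLocallyConstant.iff_eventually_eq]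
  intro x
  have h : ∀ y ∈ (Set.univ : Set Y), ∀ᶠ p : X × Y in 𝓝 (x, y), f p.1 p.2 = f x p.2 := by
    intro y _
    have h1 : Continuous fun p : X × Y => f x p.2 :=
      hf.comp ((continuous_const (y := x)).prodMk continuous_snd)
    have h2 : IsOpen {p : X × Y | f p.1 p.2 = f x p.2} :=
      (isOpen_discrete {q : Z × Z | q.1 = q.2}).preimage (hf.prodMk h1)
    exact h2.mem_nhds rfl
  filter_upwards [isCompact_univ.eventually_forall_of_forall_eventually
    (P := fun x' y => f x' y = f x y) h] with x' hx'
  exact funext fun y => hx' y (Set.mem_univ y)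

theorem exists_equivariant_of_free {Γ Y : Type*} [Group Γ] [MulAction Γ Y]
    (hfree : ∀ (γ : Γ) (y : Y), γ • y = y → γ = 1) :
    ∃ f : Y → Γ, ∀ γ y, f (γ • y) = γ * f y := by
  have h : ∀ y : Y, ∃ γ : Γ, γ • (Quotient.out (s := MulAction.orbitRel Γ Y) ⟦y⟧) = y := by
    intro y
    have : (MulAction.orbitRel Γ Y) y (Quotient.out (s := MulAction.orbitRel Γ Y) ⟦y⟧) :=
      Quotient.exact (Quotient.out_eq _).symm
    exact this
  choose f hf using h
  refine ⟨f, fun γ y => ?_⟩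
  have h1 : (⟦γ • y⟧ : Quotient (MulAction.orbitRel Γ Y)) = ⟦y⟧ := Quotient.sound ⟨γ, rfl⟩
  have h2 := hf (γ • y)
  have h3 := hf y
  rw [h1] at h2
  rw [← inv_mul_eq_one]
  refine hfree _ (Quotient.out (s := MulAction.orbitRel Γ Y) ⟦y⟧) ?_
  rw [mul_smul, inv_smul_eq_iff, h2, mul_smul, h3]

open scoped Pointwise in
/-- In a profinite group `E`, let a finite group `A` be embedded with normal image, meeting every
member of a continuously indexed family of closed subgroups `T_x` trivially. Then the torsors
`E / T_x → E / A T_x` have a trivialization which is continuous in `x`. Near a point `x₀`, all `T_x`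
lie in an open subgroup `L ⊇ T_{x₀}` which still meets `A` trivially, and `A` acts freely on the
finite set `E / L`. -/
theorem exists_continuous_retraction {E X A : Type u} [Group E] [TopologicalSpace E]
    [IsTopologicalGroup E] [CompactSpace E] [TotallyDisconnectedSpace E]
    [TopologicalSpace X] [CompactSpace X] [T2Space X] [TotallyDisconnectedSpace X]
    [AddCommGroup A] [TopologicalSpace A] [Finite A]
    (inl : Multiplicative A →* E) (hinj : Function.Injective inl)
    (hnorm : inl.range.Normal)
    (T : SubgroupFamily E X) (hT : ∀ x a, inl a ∈ T.sub x → inl a = 1) :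
    ∃ r : E → X → A, (Continuous fun p : E × X => r p.1 p.2) ∧
      (∀ a e x, r (inl (Multiplicative.ofAdd a) * e) x = a + r e x) ∧
      ∀ e t x, t ∈ T.sub x → r (e * t) x = r e x := by
  let P : X → (E → A) → Prop := fun x d => Continuous d ∧
    (∀ a e, d (inl (Multiplicative.ofAdd a) * e) = a + d e) ∧ ∀ e t, t ∈ T.sub x → d (e * t) = d e
  suffices h : ∀ x, ∃ d, ∀ᶠ y in 𝓝 x, P y d by
    obtain ⟨f, hf, hfP⟩ := exists_isLocallyConstant_choice h
    refine ⟨fun e x => f x e, ?_, fun a e x => (hfP x).2.1 a e, fun e t x ht => (hfP x).2.2 e t ht⟩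
    exact (continuous_uncurry_of_isLocallyConstant hf fun x => (hfP x).1).comp continuous_swap
  intro x₀
  have hclosed : IsClosed (T.sub x₀ : Set E) :=
    T.isClosed.preimage ((continuous_id).prodMk (continuous_const (y := x₀)))
  -- a neighbourhood `W` of `1` such that `a W` misses `T_{x₀}` for all nontrivial `a` in `A`
  obtain ⟨U, hU⟩ : ∃ U : OpenNormalSubgroup E,
      (U : Set E) ⊆ ⋂ a : {a : Multiplicative A // inl a ≠ 1}, {w | inl a.1 * w ∉ T.sub x₀} := by
    refine ProfiniteGrp.exist_openNormalSubgroup_sub_open_nhds_of_one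
      (isOpen_iInter_of_finite fun a => ?_) ?_
    · exact hclosed.isOpen_compl.preimage (continuous_const_mul (inl a.1))
    · simp only [Set.mem_iInter, Set.mem_ofPred_eq, mul_one]
      exact fun a ha => a.2 (hT x₀ a.1 ha)
  let L : Subgroup E := T.sub x₀ ⊔ U.toSubgroup
  have hLopen : IsOpen (L : Set E) :=
    Subgroup.isOpen_mono (le_sup_right : U.toSubgroup ≤ L) U.isOpen'
  have hLA : ∀ a : Multiplicative A, inl a ∈ L → a = 1 := by
    intro a ha
    by_contra hne
    have hne' : inl a ≠ 1 := fun h => hne (hinj (h.trans inl.map_one.symm))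
    have ha' : inl a ∈ ((T.sub x₀ : Set E) * (U.toSubgroup : Set E)) := by
      rw [← Subgroup.mul_normal]; exact ha
    obtain ⟨t, ht, w, hw, htw⟩ := ha'
    have h1 := Set.mem_iInter.1 (hU (U.toSubgroup.inv_mem hw)) ⟨a, hne'⟩
    refine h1 ?_
    change inl a * w⁻¹ ∈ T.sub x₀
    rw [← htw]
    simpa using ht
  have hev : ∀ᶠ y in 𝓝 x₀, T.sub y ≤ L := by
    have hc : IsClosed (Prod.snd '' ({gx : E × X | gx.1 ∈ T.sub gx.2} ∩ (Lᶜ : Set E) ×ˢ Set.univ)) :=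
      isClosedMap_snd_of_compactSpace _
        (T.isClosed.inter (hLopen.isClosed_compl.prod isClosed_univ))
    filter_upwards [hc.isOpen_compl.mem_nhds (x := x₀) (by
      rintro ⟨⟨e, y⟩, ⟨h1, h2, -⟩, rfl⟩
      exact h2 ((le_sup_left : T.sub y ≤ L) h1))] with y hy e he
    by_contra heL
    exact hy ⟨(e, y), ⟨he, heL, trivial⟩, rfl⟩
  let _ : MulAction (Multiplicative A) (E ⧸ L) := MulAction.compHom _ inl
  have hsmul : ∀ (a : Multiplicative A) (e : E), a • (e : E ⧸ L) = ((inl a * e : E) : E ⧸ L) :=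
    fun _ _ => rfl
  obtain ⟨f, hf⟩ := exists_equivariant_of_free (Γ := Multiplicative A) (Y := E ⧸ L) (by
    intro a y
    induction y using QuotientGroup.induction_on with
    | H e =>
      rw [hsmul, eq_comm, QuotientGroup.eq]
      intro h
      obtain ⟨b, hb⟩ := hnorm.conj_mem _ ⟨a, rfl⟩ e⁻¹
      rw [inv_inv] at hb
      rw [← mul_assoc, ← hb] at h
      have hb1 := hLA b h
      rw [hb1, map_one] at hb
      apply hinj
      rw [map_one]
      have := congrArg (fun z => e * z * e⁻¹) hb
      simpa [mul_assoc] using this.symm)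
  have : DiscreteTopology (E ⧸ L) := QuotientGroup.discreteTopology hLopen
  refine ⟨fun e => (f (e : E ⧸ L)).toAdd, hev.mono fun y hy => ⟨?_, ?_, ?_⟩⟩
  · exact (continuous_of_discreteTopology (f := fun z : E ⧸ L => (f z).toAdd)).comp
      QuotientGroup.continuous_mk
  · intro a e
    change (f ((inl (Multiplicative.ofAdd a) * e : E) : E ⧸ L)).toAdd = _
    rw [← hsmul, hf]; rfl
  · intro e t ht
    dsimp only
    rw [QuotientGroup.mk_mul_of_mem e (hy ht)]

/-! ### Homomorphisms out of `ℤ_π` and out of free profinite modules -/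

section Free

variable {π : Set Nat.Primes}

/-- `ℤ` is dense in `ℤ_π`, by the Chinese remainder theorem. -/
theorem ZPi.hom_eq_zero {A : Type*} [AddCommGroup A] [TopologicalSpace A] [DiscreteTopology A]
    (ψ : ZPi π →+ A) (hψ : Continuous ψ) (h1 : ψ 1 = 0) (c : ZPi π) : ψ c = 0 := by
  have hker : {c : ZPi π | ψ c = 0} ∈ 𝓝 (0 : ZPi π) :=
    ((isOpen_discrete {(0 : A)}).preimage hψ).mem_nhds (map_zero ψ)
  rw [nhds_pi, Filter.mem_pi] at hker
  obtain ⟨I, hI, t, ht, hsub⟩ := hker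
  have hk : ∀ p : π, ∃ k : ℕ, ∀ x : ℤ_[((p : Nat.Primes) : ℕ)],
      x ∈ Ideal.span {(((p : Nat.Primes) : ℕ) : ℤ_[((p : Nat.Primes) : ℕ)]) ^ k} → x ∈ t p := by
    intro p
    obtain ⟨ε, hε, hball⟩ := Metric.mem_nhds_iff.1 (ht p)
    obtain ⟨k, hk⟩ := PadicInt.exists_pow_neg_lt ((p : Nat.Primes) : ℕ) hε
    refine ⟨k, fun x hx => hball ?_⟩
    exact mem_ball_zero_iff.2 (((PadicInt.norm_le_pow_iff_mem_span_pow x k).2 hx).trans_lt hk)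
  choose k hk using hk
  obtain ⟨n, hn⟩ := Nat.chineseRemainderOfFinset (fun p : π => (c p).appr (k p))
    (fun p : π => ((p : Nat.Primes) : ℕ) ^ k p) hI.toFinset
    (fun p _ => pow_ne_zero _ (p : Nat.Primes).2.ne_zero)
    (fun p _ q _ hpq => Nat.Coprime.pow _ _ ((Nat.coprime_primes p.1.2 q.1.2).2
      fun h => hpq (Subtype.ext (Subtype.ext h))))
  have h2 : c - (n : ZPi π) ∈ I.pi t := by
    intro p hp
    refine hk p _ ?_
    have h3 := PadicInt.appr_spec (k p) (c p)
    have h4 : (((c p).appr (k p) : ℤ_[((p : Nat.Primes) : ℕ)]) - n) ∈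
        Ideal.span {(((p : Nat.Primes) : ℕ) : ℤ_[((p : Nat.Primes) : ℕ)]) ^ k p} := by
      rw [Ideal.mem_span_singleton]
      have h5 := (Nat.modEq_iff_dvd.1 (hn p (hI.mem_toFinset.2 hp)))
      have h6 := map_dvd (Int.castRingHom ℤ_[((p : Nat.Primes) : ℕ)]) h5
      simpa using h6
    have h7 := Ideal.add_mem _ h3 h4
    simpa using h7
  have h3 : ψ (c - (n : ZPi π)) = 0 := hsub h2
  rw [map_sub, ← nsmul_one, map_nsmul, h1, smul_zero, sub_zero] at h3
  exact h3

/-- Every element of `A` is torsion, of an order which involves only primes in `π`. -/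
def PiTorsion (π : Set Nat.Primes) (A : Type*) [AddCommGroup A] : Prop :=
  ∀ a : A, ∃ n : ℕ, 0 < n ∧ n • a = 0 ∧ ∀ p : Nat.Primes, (p : ℕ) ∣ n → p ∈ π

theorem continuous_toZModPow_comp {p : Nat.Primes} {A : Type*} [AddCommGroup A]
    [TopologicalSpace A] [DiscreteTopology A] [IsTopologicalAddGroup A] (k : ℕ)
    (f : ZMod ((p : ℕ) ^ k) →+ A) :
    Continuous (f.comp (PadicInt.toZModPow (p := p) k).toAddMonoidHom) := by
  refine continuous_of_continuousAt_zero _ ?_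
  rw [ContinuousAt, map_zero, nhds_discrete A, Filter.tendsto_pure]
  have hpos : (0 : ℝ) < ((p : ℕ) : ℝ) ^ (-(k : ℤ)) := zpow_pos (by exact_mod_cast p.2.pos) _
  filter_upwards [Metric.closedBall_mem_nhds (0 : ℤ_[(p : ℕ)]) hpos] with x hx
  rw [mem_closedBall_zero_iff, PadicInt.norm_le_pow_iff_mem_span_pow, ← PadicInt.ker_toZModPow,
    RingHom.mem_ker] at hx
  change f (PadicInt.toZModPow k x) = 0
  rw [hx, map_zero]

/-- The action of `ℤ_π` on an element `a` of `A`, as a continuous function of the scalar. It is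
obtained from `ℤ_p → ℤ/p^k` when `a` has prime power order, and in general from Bezout's identity. -/
theorem PiTorsion.exists_hom {A : Type*} [AddCommGroup A] [TopologicalSpace A]
    [DiscreteTopology A] (hA : PiTorsion π A) (a : A) :
    ∃ ψ : ZPi π →+ A, Continuous ψ ∧ ψ 1 = a := by
  have : IsTopologicalAddGroup A := inferInstance
  suffices key : ∀ n : ℕ, 0 < n → (∀ p : Nat.Primes, (p : ℕ) ∣ n → p ∈ π) → ∀ a : A, n • a = 0 →
      ∃ ψ : ZPi π →+ A, Continuous ψ ∧ ψ 1 = a by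
    obtain ⟨n, hn, hna, hp⟩ := hA a
    exact key n hn hp a hna
  intro n
  induction n using Nat.recOnPosPrimePosCoprime with
  | prime_pow p k hp hk =>
    intro _ hπ a ha
    obtain ⟨P, rfl⟩ : ∃ P : Nat.Primes, (P : ℕ) = p := ⟨⟨p, hp⟩, rfl⟩
    have hpπ : P ∈ π := hπ P (dvd_pow_self _ hk.ne')
    let f : ZMod ((P : ℕ) ^ k) →+ A := ZMod.lift _ ⟨zmultiplesHom A a, by
      rw [zmultiplesHom_apply, natCast_zsmul]; exact ha⟩
    refine ⟨(f.comp (PadicInt.toZModPow (p := P) k).toAddMonoidHom).comp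
      (Pi.evalAddMonoidHom _ (⟨P, hpπ⟩ : π)),
      (continuous_toZModPow_comp k f).comp (continuous_apply (⟨P, hpπ⟩ : π)), ?_⟩
    change f (PadicInt.toZModPow k (1 : ℤ_[(P : ℕ)])) = a
    rw [map_one]
    have := ZMod.lift_coe ((P : ℕ) ^ k) ⟨zmultiplesHom A a, by
      rw [zmultiplesHom_apply, natCast_zsmul]; exact ha⟩ 1
    simpa using this
  | zero => exact fun h => (lt_irrefl _ h).elim
  | one =>
    intro _ _ a ha
    rw [one_smul] at ha
    exact ⟨0, continuous_const, ha.symm⟩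
  | coprime m n hm hn hmn ihm ihn =>
    intro _ hπ a ha
    obtain ⟨ψ, hψ, hψ1⟩ := ihm (by lia) (fun p hp => hπ p (hp.mul_right n)) (n • a)
      (by rw [smul_smul, ha])
    obtain ⟨χ, hχ, hχ1⟩ := ihn (by lia) (fun p hp => hπ p (hp.mul_left m)) (m • a)
      (by rw [smul_smul, mul_comm, ha])
    refine ⟨Nat.gcdB m n • ψ + Nat.gcdA m n • χ, (hψ.zsmul _).add (hχ.zsmul _), ?_⟩
    change Nat.gcdB m n • ψ 1 + Nat.gcdA m n • χ 1 = a
    have h := Nat.gcd_eq_gcd_ab m n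
    rw [hmn] at h
    rw [hψ1, hχ1, ← natCast_zsmul, ← natCast_zsmul, smul_smul, smul_smul, ← add_smul]
    have h' : Nat.gcdB m n * (n : ℤ) + Nat.gcdA m n * (m : ℤ) = 1 := by
      push_cast at h; linarith
    rw [h', one_smul]

variable {Z : Type u} [TopologicalSpace Z]

/-- The measure `c δ_z`, as a function of the scalar `c`. -/
def FreeMod.pointMass (π : Set Nat.Primes) (z : Z) : ZPi π →+ FreeMod π Z where
  toFun c := AddMonoidHom.mk' (fun f => ((f z : ℤ) : ZPi π) * c) (fun f g => by simp [add_mul])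
  map_zero' := FreeMod.ext fun _ => mul_zero _
  map_add' _ _ := FreeMod.ext fun _ => mul_add _ _ _

theorem FreeMod.pointMass_one (z : Z) : FreeMod.pointMass π z 1 = FreeMod.basis π z :=
  FreeMod.ext fun _ => mul_one _

theorem FreeMod.continuous_pointMass (z : Z) : Continuous (FreeMod.pointMass π z) :=
  continuous_induced_rng.2 (continuous_pi fun _ => continuous_const.mul continuous_id)

theorem FreeMod.add_apply (μ ν : FreeMod π Z) (f : LocallyConstant Z ℤ) :
    (μ + ν) f = μ f + ν f := rfl

theorem FreeMod.sub_apply (μ ν : FreeMod π Z) (f : LocallyConstant Z ℤ) :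
    (μ - ν) f = μ f - ν f := rfl

theorem FreeMod.continuous_apply (f : LocallyConstant Z ℤ) :
    Continuous fun μ : FreeMod π Z => μ f :=
  (_root_.continuous_apply f).comp continuous_induced_dom

instance : IsTopologicalAddGroup (FreeMod π Z) where
  continuous_add := continuous_induced_rng.2 (continuous_pi fun f =>
    ((FreeMod.continuous_apply f).comp continuous_fst).add
      ((FreeMod.continuous_apply f).comp continuous_snd))
  continuous_neg := continuous_induced_rng.2 (continuous_pi fun f =>
    (FreeMod.continuous_apply f).neg)

/-- The map `μ ↦ μ(f)`, as a homomorphism. -/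
def FreeMod.evalAt (f : LocallyConstant Z ℤ) : FreeMod π Z →+ ZPi π where
  toFun μ := μ f
  map_zero' := rfl
  map_add' _ _ := rfl

/-- The free profinite module is compact, being closed in a product of copies of `ℤ_π`. -/
instance : CompactSpace (FreeMod π Z) := by
  let Φ : FreeMod π Z → (LocallyConstant Z ℤ → ZPi π) := fun μ f => μ f
  have hind : IsInducing Φ := ⟨rfl⟩
  have hrange : Set.range Φ = ⋂ (f : LocallyConstant Z ℤ) (g : LocallyConstant Z ℤ),
      {F | F (f + g) = F f + F g} := by
    ext F
    simp only [Set.mem_range, Set.mem_iInter, Set.mem_ofPred_eq]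
    constructor
    · rintro ⟨μ, rfl⟩ f g
      exact map_add μ f g
    · intro h
      exact ⟨AddMonoidHom.mk' F h, rfl⟩
  have hcl : IsClosed (Set.range Φ) := by
    rw [hrange]
    exact isClosed_iInter fun f => isClosed_iInter fun g => isClosed_eq
      (_root_.continuous_apply (f + g))
      ((_root_.continuous_apply f : Continuous fun F : LocallyConstant Z ℤ → ZPi π => F f).add
        (_root_.continuous_apply g : Continuous fun F : LocallyConstant Z ℤ → ZPi π => F g))
  exact ⟨by rw [hind.isCompact_iff, Set.image_univ]; exact hcl.isCompact⟩

/-- The indicator function of a fibre of a locally constant function. -/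
def fibreFn {A : Type*} (f : LocallyConstant Z A) (a : A) : LocallyConstant Z ℤ :=
  open Classical in f.map (fun b => if b = a then 1 else 0)

theorem fibreFn_apply {A : Type*} [DecidableEq A] (f : LocallyConstant Z A) (a : A) (z : Z) :
    fibreFn f a z = if f z = a then 1 else 0 := by
  rw [fibreFn, LocallyConstant.map_apply, Function.comp_apply]
  split_ifs <;> rfl

/-- A function `h` which is constant on the fibres of `f` is the sum of the indicator functions of
these fibres, weighted by the values of `h`. -/
theorem FreeMod.apply_eq_sum_fibreFn [CompactSpace Z] {A : Type*} (f : LocallyConstant Z A)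
    (z : A → Z) (hz : ∀ a ∈ Set.range f, f (z a) = a) (h : LocallyConstant Z ℤ)
    (hh : ∀ y y', f y = f y' → h y = h y') (μ : FreeMod π Z) :
    μ h = ∑ a ∈ f.range_finite.toFinset, ((h (z a) : ℤ) : ZPi π) * μ (fibreFn f a) := by
  classical
  have : h = ∑ a ∈ f.range_finite.toFinset, h (z a) • fibreFn f a := by
    ext y
    have hs : (∑ a ∈ f.range_finite.toFinset, h (z a) • fibreFn f a) y =
        ∑ a ∈ f.range_finite.toFinset, h (z a) * fibreFn f a y := by
      have := map_sum (LocallyConstant.evalAddMonoidHom y : LocallyConstant Z ℤ →+ ℤ)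
        (fun a => h (z a) • fibreFn f a) f.range_finite.toFinset
      exact this
    rw [hs, Finset.sum_eq_single (f y)]
    · rw [fibreFn_apply, if_pos rfl, mul_one]
      exact hh _ _ (hz _ ⟨y, rfl⟩).symm
    · intro a _ ha
      rw [fibreFn_apply, if_neg ha.symm, mul_zero]
    · intro hn
      exact (hn (f.range_finite.mem_toFinset.2 ⟨y, rfl⟩)).elim
  conv_lhs => rw [this]
  rw [map_sum]
  refine Finset.sum_congr rfl fun a _ => ?_
  rw [map_zsmul, zsmul_eq_mul]

variable {A : Type*} [AddCommGroup A] [TopologicalSpace A] [DiscreteTopology A]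

/-- A continuous homomorphism to a discrete module which vanishes on the basis is zero: it kills
all `c δ_z`, and up to an element of an open subgroup in its kernel every measure is a finite sum
of such. -/
theorem FreeMod.chom_eq_zero [CompactSpace Z] (φ : CHom (FreeMod π Z) A)
    (h : ∀ z, φ (FreeMod.basis π z) = 0) : φ = 0 := by
  classical
  have hpm : ∀ z c, φ (FreeMod.pointMass π z c) = 0 := fun z c =>
    ZPi.hom_eq_zero ((φ : FreeMod π Z →+ A).comp (FreeMod.pointMass π z))
      ((map_continuous φ).comp (FreeMod.continuous_pointMass z))
      (by change φ (FreeMod.pointMass π z 1) = 0; rw [FreeMod.pointMass_one, h]) c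
  refine CHom.ext fun μ => ?_
  have hker : {μ : FreeMod π Z | φ μ = 0} ∈ 𝓝 (0 : FreeMod π Z) :=
    ((isOpen_discrete {(0 : A)}).preimage (map_continuous φ)).mem_nhds (map_zero φ)
  rw [nhds_induced, Filter.mem_comap] at hker
  obtain ⟨V, hV, hsub⟩ := hker
  rw [nhds_pi, Filter.mem_pi] at hV
  obtain ⟨I, hI, t, ht, htV⟩ := hV
  have : Finite I := hI
  -- the common refinement of the partitions given by the functions in `I`
  let F : LocallyConstant Z (I → ℤ) := LocallyConstant.unflip fun i : I => i.1
  rcases isEmpty_or_nonempty Z with hZ | ⟨⟨z₀⟩⟩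
  · have : μ = 0 := FreeMod.ext fun f => by
      have hf : f = 0 := LocallyConstant.ext fun z => hZ.elim z
      rw [hf, map_zero, map_zero]
    rw [this, map_zero]; rfl
  let z : (I → ℤ) → Z := fun v => if hv : v ∈ Set.range F then hv.choose else z₀
  have hz : ∀ v ∈ Set.range F, F (z v) = v := by
    intro v hv
    simp only [z, dif_pos hv]
    exact hv.choose_spec
  let ν : FreeMod π Z := ∑ v ∈ F.range_finite.toFinset,
    FreeMod.pointMass π (z v) (μ (fibreFn F v))
  have hν : φ ν = 0 := by
    rw [map_sum]
    exact Finset.sum_eq_zero fun v _ => hpm _ _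
  have hμν : ∀ f ∈ I, μ f = ν f := by
    intro f hf
    rw [FreeMod.apply_eq_sum_fibreFn F z hz f (fun y y' hy => congrFun hy ⟨f, hf⟩) μ]
    exact (map_sum (FreeMod.evalAt f)
      (fun v => FreeMod.pointMass π (z v) (μ (fibreFn F v))) F.range_finite.toFinset).symm
  have hmem : φ (μ - ν) = 0 := by
    refine hsub (htV fun f hf => ?_)
    change (μ - ν) f ∈ t f
    rw [FreeMod.sub_apply, hμν f hf, sub_self]
    exact mem_of_mem_nhds (ht f)
  rw [map_sub, hν, sub_zero] at hmem
  exact hmem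

theorem FreeMod.chom_ext [CompactSpace Z] {φ ψ : CHom (FreeMod π Z) A}
    (h : ∀ z, φ (FreeMod.basis π z) = ψ (FreeMod.basis π z)) : φ = ψ := by
  rw [← sub_eq_zero]
  refine FreeMod.chom_eq_zero _ fun z => ?_
  rw [sub_eq_add_neg, CHom.add_apply, CHom.neg_apply, h, add_neg_cancel]

/-- Evaluation at a point, as a homomorphism on the group of continuous homomorphisms. -/
def CHom.evalHom {M A : Type*} [AddCommGroup M] [TopologicalSpace M] [AddCommGroup A]
    [TopologicalSpace A] [IsTopologicalAddGroup A] (m : M) : CHom M A →+ A where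
  toFun φ := φ m
  map_zero' := rfl
  map_add' _ _ := rfl

/-- The universal property of `ℤ_π⟦Z⟧`, for targets that are discrete `π`-torsion groups. -/
theorem FreeMod.exists_chom [CompactSpace Z] (hA : PiTorsion π A) (f : LocallyConstant Z A) :
    ∃ φ : CHom (FreeMod π Z) A, ∀ z, φ (FreeMod.basis π z) = f z := by
  classical
  choose ψ hψ hψ1 using hA.exists_hom
  let χ : A → CHom (FreeMod π Z) A := fun a =>
    (⟨(ψ a).comp (FreeMod.evalAt (fibreFn f a)),
      (hψ a).comp (FreeMod.continuous_apply _)⟩ : FreeMod π Z →ₜ+ A)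
  refine ⟨∑ a ∈ f.range_finite.toFinset, χ a, fun z => ?_⟩
  have h := map_sum (CHom.evalHom (A := A) (FreeMod.basis π z)) χ f.range_finite.toFinset
  change (∑ a ∈ f.range_finite.toFinset, χ a) (FreeMod.basis π z) =
    ∑ a ∈ f.range_finite.toFinset, ψ a ((fibreFn f a z : ℤ) : ZPi π) at h
  rw [h, Finset.sum_eq_single (f z)]
  · rw [fibreFn_apply, if_pos rfl, Int.cast_one, hψ1]
  · intro a _ ha
    rw [fibreFn_apply, if_neg ha.symm, Int.cast_zero, map_zero]
  · intro hn
    exact (hn (f.range_finite.mem_toFinset.2 ⟨z, rfl⟩)).elim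

theorem Delta.continuous_inc : Continuous (Delta.inc π Z) := continuous_subtype_val

/-- Restriction of homomorphisms along the inclusion of `Δ`. -/
def resDelta (π : Set Nat.Primes) (Z : Type u) [TopologicalSpace Z] (A : Type*) [AddCommGroup A]
    [TopologicalSpace A] [DiscreteTopology A] : CHom (FreeMod π Z) A →+ CHom (Delta π Z) A where
  toFun φ := (⟨(φ : FreeMod π Z →+ A).comp (Delta.inc π Z),
    (map_continuous φ).comp Delta.continuous_inc⟩ : Delta π Z →ₜ+ A)
  map_zero' := rfl
  map_add' _ _ := rfl

@[simp] theorem resDelta_apply (φ : CHom (FreeMod π Z) A) (μ : Delta π Z) :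
    resDelta π Z A φ μ = φ (Delta.inc π Z μ) := rfl

theorem resDelta_smul {G : Type*} [Group G] [MulAction G Z] [ContinuousConstSMul G Z]
    [DistribMulAction G A] [ContinuousConstSMul G A] (g : G) (φ : CHom (FreeMod π Z) A) :
    resDelta π Z A (g • φ) = g • resDelta π Z A φ := rfl

/-- The point `z₀` splits `Δ` off `ℤ_π⟦Z⟧`, so homomorphisms extend from `Δ`. -/
theorem resDelta_surjective (z₀ : Z) : Function.Surjective (resDelta π Z A) := by
  intro κ
  have hmem : ∀ μ : FreeMod π Z, ev π Z (μ - FreeMod.pointMass π z₀ (ev π Z μ)) = 0 := by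
    intro μ
    rw [map_sub, sub_eq_zero]
    change _ = ((1 : ℤ) : ZPi π) * _
    rw [Int.cast_one, one_mul]
  let pr : FreeMod π Z →+ Delta π Z := AddMonoidHom.codRestrict
    (AddMonoidHom.id _ - (FreeMod.pointMass π z₀).comp (ev π Z)) (ev π Z).ker hmem
  have hpr : Continuous pr := Continuous.subtype_mk (continuous_id.sub
    ((FreeMod.continuous_pointMass z₀).comp (FreeMod.continuous_apply _))) _
  refine ⟨(⟨(κ : Delta π Z →+ A).comp pr, (map_continuous κ).comp hpr⟩ : FreeMod π Z →ₜ+ A), ?_⟩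
  refine CHom.ext fun μ => ?_
  change κ (pr (Delta.inc π Z μ)) = κ μ
  congr 1
  refine Subtype.ext ?_
  change Delta.inc π Z μ - FreeMod.pointMass π z₀ (ev π Z (Delta.inc π Z μ)) = Delta.inc π Z μ
  have : ev π Z (Delta.inc π Z μ) = 0 := μ.2
  rw [this, map_zero, sub_zero]

/-- The homomorphism `φ` kills `Δ` if and only if it is constant on the basis. -/
theorem resDelta_eq_zero_iff [CompactSpace Z] (hA : PiTorsion π A) (φ : CHom (FreeMod π Z) A) :
    resDelta π Z A φ = 0 ↔ ∀ z z', φ (FreeMod.basis π z) = φ (FreeMod.basis π z') := by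
  constructor
  · intro h z z'
    have hmem : ev π Z (FreeMod.basis π z - FreeMod.basis π z') = 0 := by
      rw [map_sub, ev_basis, ev_basis, sub_self]
    have h1 : φ (FreeMod.basis π z - FreeMod.basis π z') = 0 :=
      DFunLike.congr_fun h (⟨_, hmem⟩ : (ev π Z).ker)
    rwa [map_sub, sub_eq_zero] at h1
  · intro h
    obtain ⟨a, ha⟩ : ∃ a, ∀ z, φ (FreeMod.basis π z) = a := by
      rcases isEmpty_or_nonempty Z with hZ | ⟨⟨z₀⟩⟩
      · exact ⟨0, fun z => hZ.elim z⟩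
      · exact ⟨_, fun z => h z z₀⟩
    obtain ⟨ψ, hψ, hψ1⟩ := hA.exists_hom a
    let χ : CHom (FreeMod π Z) A :=
      (⟨ψ.comp (ev π Z), hψ.comp (FreeMod.continuous_apply _)⟩ : FreeMod π Z →ₜ+ A)
    have hφ : φ = χ := FreeMod.chom_ext fun z => by
      rw [ha]
      change a = ψ (ev π Z (FreeMod.basis π z))
      rw [ev_basis, hψ1]
    refine CHom.ext fun μ => ?_
    rw [hφ]
    change ψ (ev π Z (Delta.inc π Z μ)) = 0
    have : ev π Z (Delta.inc π Z μ) = 0 := μ.2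
    rw [this, map_zero]

end Free

/-! ### Cocycles and coboundaries in low degrees -/

section LowDegree

theorem vec_one_eta {G : Type*} (v : Fin 1 → G) : ![v 0] = v := by
  ext i; fin_cases i; rfl

theorem vec_two_eta {G : Type*} (v : Fin 2 → G) : ![v 0, v 1] = v := by
  ext i; fin_cases i <;> rfl

theorem vec_three_eta {G : Type*} (v : Fin 3 → G) : ![v 0, v 1, v 2] = v := by
  ext i; fin_cases i <;> rfl

variable {G M : Type u} [Group G] [TopologicalSpace G] [AddCommGroup M] [DistribMulAction G M]

theorem continuous_vec_one : Continuous fun g : G => ![g] :=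
  continuous_pi fun i => by fin_cases i; exact continuous_id

theorem mem_cocycles_one {f : (Fin 1 → G) → M} : f ∈ cocycles G M 1 ↔
    IsLocallyConstant f ∧ ∀ g h, g • f ![h] - f ![g * h] + f ![g] = 0 := by
  refine and_congr Iff.rfl ⟨fun h a b => ?_, fun h => ?_⟩
  · rw [← cochainD_one]; exact congrFun h _
  · exact funext fun v => by rw [← vec_two_eta v, cochainD_one, h]; rfl

theorem mem_cocycles_two {f : (Fin 2 → G) → M} : f ∈ cocycles G M 2 ↔
    IsLocallyConstant f ∧
      ∀ g h k, g • f ![h, k] - f ![g * h, k] + f ![g, h * k] - f ![g, h] = 0 := by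
  refine and_congr Iff.rfl ⟨fun h a b c => ?_, fun h => ?_⟩
  · rw [← cochainD_two]; exact congrFun h _
  · exact funext fun v => by rw [← vec_three_eta v, cochainD_two, h]; rfl

theorem cochainD_zero (f : (Fin 0 → G) → M) (g : G) :
    cochainD G M 0 f ![g] = g • f ![] - f ![] := by
  change g • f _ + ∑ j : Fin 1, (-1 : ℤ) ^ ((j : ℕ) + 1) • f _ = _
  simp [Subsingleton.elim (α := Fin 0 → G) _ ![], sub_eq_add_neg]

theorem mem_coboundaries_one {f : (Fin 1 → G) → M} : f ∈ coboundaries G M 1 ↔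
    ∃ m : M, ∀ g, f ![g] = g • m - m := by
  constructor
  · rintro ⟨κ, -, rfl⟩
    exact ⟨κ ![], fun g => cochainD_zero κ g⟩
  · rintro ⟨m, hm⟩
    exact ⟨fun _ => m, IsLocallyConstant.const m, funext fun v => by
      rw [← vec_one_eta v, cochainD_zero, hm]⟩

theorem mem_coboundaries_two {f : (Fin 2 → G) → M} : f ∈ coboundaries G M 2 ↔
    ∃ b : G → M, IsLocallyConstant b ∧ ∀ g h, f ![g, h] = g • b h - b (g * h) + b g := by
  constructor
  · rintro ⟨β, hβ, rfl⟩
    exact ⟨fun g => β ![g], (show IsLocallyConstant β from hβ).comp_continuous continuous_vec_one,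
      fun g h => cochainD_one β g h⟩
  · rintro ⟨b, hb, h⟩
    exact ⟨fun v => b (v 0), hb.comp_continuous (continuous_apply 0), funext fun v => by
      rw [← vec_two_eta v, cochainD_one, h]; rfl⟩

end LowDegree

/-! ### Cochains representing a relative class -/

section Classes

variable {G X : Type u} [Group G] [TopologicalSpace G] [IsTopologicalGroup G] [CompactSpace G]
  [TotallyDisconnectedSpace G] [TopologicalSpace X] [CompactSpace X] {𝒮 : SubgroupFamily G X}
  {π : Set Nat.Primes}
  {A : Type u} [AddCommGroup A] [DistribMulAction G A] [TopologicalSpace A]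
  [DiscreteTopology A] [ContinuousSMul G A]

instance : CompactSpace 𝒮.CosetSpace :=
  inferInstanceAs (CompactSpace (Quotient 𝒮.cosetSetoid))

theorem SubgroupFamily.coset_surjective (z : 𝒮.CosetSpace) : ∃ g x, 𝒮.coset g x = z := by
  induction z using Quotient.inductionOn with
  | h a => exact ⟨a.1, a.2, rfl⟩

theorem SubgroupFamily.inv_smul_coset_one {x : X} {s : G} (hs : s ∈ 𝒮.sub x) :
    s⁻¹ • 𝒮.coset 1 x = 𝒮.coset 1 x := by
  rw [SubgroupFamily.smul_coset, mul_one]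
  simpa using 𝒮.coset_eq_of_mem ((𝒮.sub x).inv_mem hs) 1

theorem isLocallyConstant_cochain_one (η : cochains G (HomFree 𝒮 π A) 1) :
    IsLocallyConstant fun g => η.1 ![g] :=
  (show IsLocallyConstant η.1 from η.2).comp_continuous continuous_vec_one

theorem continuous_cochain_one_apply (η : cochains G (HomFree 𝒮 π A) 1) :
    Continuous fun p : G × 𝒮.CosetSpace => η.1 ![p.1] (FreeMod.basis π p.2) :=
  continuous_uncurry_of_isLocallyConstant
    ((isLocallyConstant_cochain_one η).comp fun φ z => φ (FreeMod.basis π z))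
    fun g => (map_continuous (η.1 ![g])).comp FreeMod.continuous_basis

theorem cochainD_one_apply_basis (η : (Fin 1 → G) → HomFree 𝒮 π A) (g h : G)
    (z : 𝒮.CosetSpace) :
    cochainD G (HomFree 𝒮 π A) 1 η ![g, h] (FreeMod.basis π z) =
      g • η ![h] (FreeMod.basis π (g⁻¹ • z)) - η ![g * h] (FreeMod.basis π z) +
        η ![g] (FreeMod.basis π z) := by
  rw [cochainD_one, sub_eq_add_neg, CHom.add_apply, CHom.add_apply, CHom.neg_apply,
    CHom.smul_apply, FreeMod.smul_basis, sub_eq_add_neg]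

theorem Bounds.apply {η : cochains G (HomFree 𝒮 π A) 1} {ζ : cocycles G A 2} (h : Bounds π η ζ)
    (g k : G) (z : 𝒮.CosetSpace) :
    ζ.1 ![g, k] = g • η.1 ![k] (FreeMod.basis π (g⁻¹ • z)) - η.1 ![g * k] (FreeMod.basis π z) +
      η.1 ![g] (FreeMod.basis π z) := by
  rw [← cochainD_one_apply_basis, h]

theorem bounds_iff {η : cochains G (HomFree 𝒮 π A) 1} {ζ : cocycles G A 2} : Bounds π η ζ ↔
    ∀ (g k : G) (z : 𝒮.CosetSpace), ζ.1 ![g, k] =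
      g • η.1 ![k] (FreeMod.basis π (g⁻¹ • z)) - η.1 ![g * k] (FreeMod.basis π z) +
        η.1 ![g] (FreeMod.basis π z) := by
  refine ⟨fun h g k z => h.apply g k z, fun h v z => ?_⟩
  rw [← vec_two_eta v, cochainD_one_apply_basis, h]

theorem Bounds.sub {η η' : cochains G (HomFree 𝒮 π A) 1} {ζ ζ' : cocycles G A 2}
    (h : Bounds π η ζ) (h' : Bounds π η' ζ') : Bounds π (η - η') (ζ - ζ') := by
  rw [bounds_iff] at h h' ⊢
  intro g k z
  change ζ.1 _ - ζ'.1 _ = g • (η.1 _ - η'.1 _ : HomFree 𝒮 π A) _ -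
    (η.1 _ - η'.1 _ : HomFree 𝒮 π A) _ + (η.1 _ - η'.1 _ : HomFree 𝒮 π A) _
  rw [h g k z, h' g k z]
  simp only [sub_eq_add_neg, CHom.add_apply, CHom.neg_apply, smul_add, smul_neg]
  abel

/-- The cochain with values in `Hom(Δ, A)` obtained by restricting `η`. -/
def resCochain (η : cochains G (HomFree 𝒮 π A) 1) : (Fin 1 → G) → HomDelta 𝒮 π A :=
  fun g => resDelta π 𝒮.CosetSpace A (η.1 g)

theorem Bounds.resCochain_mem (hA : PiTorsion π A) {η : cochains G (HomFree 𝒮 π A) 1}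
    {ζ : cocycles G A 2} (h : Bounds π η ζ) : resCochain η ∈ cocycles G (HomDelta 𝒮 π A) 1 := by
  rw [mem_cocycles_one]
  refine ⟨(show IsLocallyConstant η.1 from η.2).comp _, fun g k => ?_⟩
  have h1 : resDelta π 𝒮.CosetSpace A (cochainD G (HomFree 𝒮 π A) 1 η.1 ![g, k]) = 0 :=
    (resDelta_eq_zero_iff hA _).2 fun z z' => by rw [h, h]
  rw [cochainD_one, map_add, map_sub, resDelta_smul] at h1
  exact h1

/-- The class `c ∈ H²(G, 𝒮; A)` is given by the cochains `η` and `ζ`: its first component by `ζ`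
if `X` is empty, and its second component by the restriction of `η`. -/
def IsClassOf (c : relCohomologySucc 𝒮 π A 1) (η : cochains G (HomFree 𝒮 π A) 1)
    (ζ : cocycles G A 2) : Prop :=
  (∃ ξ : cocycles G (HomDelta 𝒮 π A) 1, ξ.1 = resCochain η ∧ c.1.2 = QuotientAddGroup.mk ξ) ∧
    (IsEmpty X → c.1.1 = QuotientAddGroup.mk ζ)

theorem RelExtension.represents_iff [Finite A] {R : RelExtension 𝒮 A}
    {c : relCohomologySucc 𝒮 π A 1} : R.Represents π c ↔
      ∃ (η : cochains G (HomFree 𝒮 π A) 1) (ζ : cocycles G A 2) (h : Bounds π η ζ),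
        IsClassOf c η ζ ∧ R.Equivalent (RelExtension.ofCochains η ζ h) := by
  constructor
  · rintro ⟨ξ, η, ζ, h, h1, h2, h3, h4⟩
    exact ⟨η, ζ, h, ⟨⟨ξ, funext fun g => CHom.ext fun μ => h1 g μ, h2⟩, h3⟩, h4⟩
  · rintro ⟨η, ζ, h, ⟨⟨ξ, h1, h2⟩, h3⟩, h4⟩
    exact ⟨ξ, η, ζ, h, fun g μ => by rw [h1]; rfl, h2, h3, h4⟩

theorem mk_eq_zero_iff {M : Type*} [AddCommGroup M] [DistribMulAction G M] {n : ℕ}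
    {f : cocycles G M n} :
    (QuotientAddGroup.mk f : Cohomology G M n) = 0 ↔ f.1 ∈ coboundaries G M n := by
  rw [QuotientAddGroup.eq_zero_iff, AddSubgroup.mem_addSubgroupOf]

theorem IsClassOf.eq_zero_iff {c : relCohomologySucc 𝒮 π A 1}
    {η : cochains G (HomFree 𝒮 π A) 1} {ζ : cocycles G A 2} (hc : IsClassOf c η ζ) :
    c = 0 ↔ resCochain η ∈ coboundaries G (HomDelta 𝒮 π A) 1 ∧
      (IsEmpty X → ζ.1 ∈ coboundaries G A 2) := by
  obtain ⟨⟨ξ, hξ, h2⟩, h1⟩ := hc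
  rw [← hξ, ← mk_eq_zero_iff, ← h2]
  constructor
  · rintro rfl
    exact ⟨rfl, fun hX => by rw [← mk_eq_zero_iff, ← h1 hX]; rfl⟩
  · rintro ⟨h3, h4⟩
    refine Subtype.ext (Prod.ext ?_ h3)
    rcases isEmpty_or_nonempty X with hX | hX
    · rw [h1 hX]; exact mk_eq_zero_iff.2 (h4 hX)
    · exact c.2 hX

theorem IsClassOf.sub {c c' : relCohomologySucc 𝒮 π A 1}
    {η η' : cochains G (HomFree 𝒮 π A) 1} {ζ ζ' : cocycles G A 2} (hc : IsClassOf c η ζ)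
    (hc' : IsClassOf c' η' ζ') : IsClassOf (c - c') (η - η') (ζ - ζ') := by
  obtain ⟨⟨ξ, hξ, h2⟩, h1⟩ := hc
  obtain ⟨⟨ξ', hξ', h2'⟩, h1'⟩ := hc'
  refine ⟨⟨ξ - ξ', ?_, ?_⟩, fun hX => ?_⟩
  · change ξ.1 - ξ'.1 = _
    rw [hξ, hξ']
    exact funext fun g => (map_sub (resDelta π 𝒮.CosetSpace A) _ _).symm
  · change c.1.2 - c'.1.2 = _
    rw [h2, h2']; rfl
  · change c.1.1 - c'.1.1 = _
    rw [h1 hX, h1' hX]; rfl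

theorem Bounds.exists_isClassOf (hA : PiTorsion π A) {η : cochains G (HomFree 𝒮 π A) 1}
    {ζ : cocycles G A 2} (h : Bounds π η ζ) :
    ∃ c : relCohomologySucc 𝒮 π A 1, IsClassOf c η ζ := by
  rcases isEmpty_or_nonempty X with hX | hX
  · exact ⟨⟨(QuotientAddGroup.mk ζ, QuotientAddGroup.mk ⟨_, h.resCochain_mem hA⟩),
      fun hX' => (not_isEmpty_iff.2 hX' hX).elim⟩, ⟨⟨_, h.resCochain_mem hA⟩, rfl, rfl⟩,
      fun _ => rfl⟩
  · exact ⟨⟨(0, QuotientAddGroup.mk ⟨_, h.resCochain_mem hA⟩), fun _ => rfl⟩,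
      ⟨⟨_, h.resCochain_mem hA⟩, rfl, rfl⟩, fun hX' => (not_isEmpty_iff.2 hX hX').elim⟩

theorem isEmpty_cosetSpace [hX : IsEmpty X] : IsEmpty 𝒮.CosetSpace :=
  ⟨fun z => by obtain ⟨-, x, -⟩ := 𝒮.coset_surjective z; exact hX.elim x⟩

theorem homDelta_eq_of_isEmpty [hX : IsEmpty X] (φ ψ : HomDelta 𝒮 π A) : φ = ψ := by
  have : IsEmpty 𝒮.CosetSpace := isEmpty_cosetSpace
  refine CHom.ext fun μ => ?_
  have : μ = 0 := Subtype.ext (FreeMod.ext fun f => by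
    have hf : f = 0 := LocallyConstant.ext fun z => this.elim z
    rw [hf, map_zero, map_zero])
  rw [this, map_zero, map_zero]

/-- Every relative class is given by cochains: extend the values of a cocycle from `Δ` to
`ℤ_π⟦G/𝒮⟧`. The coboundary of the extension vanishes on `Δ`, and so comes from a cocycle with
values in `A`. -/
theorem exists_bounds_isClassOf (hA : PiTorsion π A) (c : relCohomologySucc 𝒮 π A 1) :
    ∃ (η : cochains G (HomFree 𝒮 π A) 1) (ζ : cocycles G A 2), Bounds π η ζ ∧
      IsClassOf c η ζ := by
  obtain ⟨ξ, hξ⟩ := QuotientAddGroup.mk_surjective c.1.2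
  rcases isEmpty_or_nonempty X with hX | ⟨⟨x₀⟩⟩
  · obtain ⟨ζ, hζ⟩ := QuotientAddGroup.mk_surjective c.1.1
    have := isEmpty_cosetSpace (𝒮 := 𝒮)
    exact ⟨0, ζ, fun g z => this.elim z, ⟨ξ, funext fun g => homDelta_eq_of_isEmpty _ _, hξ.symm⟩,
      fun _ => hζ.symm⟩
  let z₀ := 𝒮.coset 1 x₀
  obtain ⟨lift, hlift⟩ := (resDelta_surjective (π := π) (A := A) z₀).hasRightInverse
  obtain ⟨hξc, hξd⟩ := mem_cocycles_one.1 ξ.2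
  let η : cochains G (HomFree 𝒮 π A) 1 := ⟨fun v => lift (ξ.1 v), hξc.comp lift⟩
  have hηξ : ∀ v, resDelta π 𝒮.CosetSpace A (η.1 v) = ξ.1 v := fun v => hlift _
  have hconst : ∀ g k z, cochainD G (HomFree 𝒮 π A) 1 η.1 ![g, k] (FreeMod.basis π z) =
      cochainD G (HomFree 𝒮 π A) 1 η.1 ![g, k] (FreeMod.basis π z₀) := by
    intro g k z
    refine (resDelta_eq_zero_iff hA _).1 ?_ z z₀
    rw [cochainD_one, map_add, map_sub, resDelta_smul, hηξ, hηξ, hηξ, hξd]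
  simp only [cochainD_one_apply_basis] at hconst
  let ζ₀ : (Fin 2 → G) → A := fun v =>
    v 0 • η.1 ![v 1] (FreeMod.basis π ((v 0)⁻¹ • z₀)) - η.1 ![v 0 * v 1] (FreeMod.basis π z₀) +
      η.1 ![v 0] (FreeMod.basis π z₀)
  have hζc : Continuous ζ₀ := by
    have c0 : Continuous fun v : Fin 2 → G => v 0 := continuous_apply 0
    have c1 : Continuous fun v : Fin 2 → G => v 1 := continuous_apply 1
    have cz : Continuous fun v : Fin 2 → G => (v 0)⁻¹ • z₀ := by
      have : (fun v : Fin 2 → G => (v 0)⁻¹ • z₀) = fun v => 𝒮.coset (v 0)⁻¹ x₀ :=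
        funext fun v => by rw [SubgroupFamily.smul_coset, mul_one]
      rw [this]
      exact 𝒮.continuous_coset.comp (c0.inv.prodMk continuous_const)
    have hη := continuous_cochain_one_apply η
    exact ((c0.smul (hη.comp (c1.prodMk cz))).sub
      (hη.comp ((c0.mul c1).prodMk continuous_const))).add (hη.comp (c0.prodMk continuous_const))
  have hζ : ζ₀ ∈ cocycles G A 2 := by
    refine mem_cocycles_two.2 ⟨(IsLocallyConstant.iff_continuous _).2 hζc, fun g h k => ?_⟩
    have h1 : ζ₀ ![h, k] = h • η.1 ![k] (FreeMod.basis π (h⁻¹ • g⁻¹ • z₀)) -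
        η.1 ![h * k] (FreeMod.basis π (g⁻¹ • z₀)) + η.1 ![h] (FreeMod.basis π (g⁻¹ • z₀)) :=
      (hconst h k (g⁻¹ • z₀)).symm
    rw [h1]
    change _ - ((g * h) • η.1 ![k] (FreeMod.basis π ((g * h)⁻¹ • z₀)) -
      η.1 ![g * h * k] (FreeMod.basis π z₀) + η.1 ![g * h] (FreeMod.basis π z₀)) +
      (g • η.1 ![h * k] (FreeMod.basis π (g⁻¹ • z₀)) - η.1 ![g * (h * k)] (FreeMod.basis π z₀) +
        η.1 ![g] (FreeMod.basis π z₀)) -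
      (g • η.1 ![h] (FreeMod.basis π (g⁻¹ • z₀)) - η.1 ![g * h] (FreeMod.basis π z₀) +
        η.1 ![g] (FreeMod.basis π z₀)) = 0
    rw [mul_inv_rev, mul_smul h⁻¹, mul_smul g, mul_assoc, smul_add, smul_sub]
    abel
  refine ⟨η, ⟨ζ₀, hζ⟩, bounds_iff.2 fun g k z => (hconst g k z).symm,
    ⟨ξ, funext fun v => (hηξ v).symm, hξ.symm⟩, fun hX => hX.elim x₀⟩

/-! ### Vanishing of a relative class -/

/-- Cochains `b : G → A` and `a : X → A` which trivialize the pair `(η, ζ)`. They amount to a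
splitting of the relative extension defined by `(η, ζ)`. -/
def IsTrivializedBy (η : cochains G (HomFree 𝒮 π A) 1) (ζ : cocycles G A 2) (b : G → A)
    (a : X → A) : Prop :=
  Continuous b ∧ Continuous a ∧ (∀ g h, b (g * h) = b g + g • b h + ζ.1 ![g, h]) ∧
    ∀ x, ∀ s ∈ 𝒮.sub x, -(η.1 ![s] (FreeMod.basis π (𝒮.coset 1 x))) = a x + b s - s • a x

/-- Shapiro's lemma: the cochain `η + b` is a cocycle with values in the functions on `G/𝒮`. On
`S_x` its value at `1 S_x` is the coboundary of `a x`, so it is the coboundary of the function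
`h S_x ↦ h a(x) - (η + b)(h)(h S_x)`. -/
theorem IsTrivializedBy.mem_coboundaries (hA : PiTorsion π A)
    {η : cochains G (HomFree 𝒮 π A) 1} {ζ : cocycles G A 2} (h : Bounds π η ζ) {b : G → A}
    {a : X → A} (hab : IsTrivializedBy η ζ b a) :
    resCochain η ∈ coboundaries G (HomDelta 𝒮 π A) 1 ∧ ζ.1 ∈ coboundaries G A 2 := by
  obtain ⟨hb, ha, hζ, hη⟩ := hab
  -- the cocycle identity for `η + b`
  have hηmul : ∀ g k z, η.1 ![g * k] (FreeMod.basis π z) + b (g * k) =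
      η.1 ![g] (FreeMod.basis π z) + b g +
        g • (η.1 ![k] (FreeMod.basis π (g⁻¹ • z)) + b k) := by
    intro g k z
    have h1 := h.apply g k z
    rw [hζ, h1, smul_add]
    abel
  let F : G × X → A := fun p =>
    p.1 • a p.2 - (η.1 ![p.1] (FreeMod.basis π (𝒮.coset p.1 p.2)) + b p.1)
  have hF : ∀ p q, 𝒮.cosetSetoid p q → F p = F q := by
    rintro ⟨k, x⟩ ⟨k', x'⟩ ⟨hx, hs⟩
    obtain rfl : x = x' := hx
    obtain ⟨s, rfl⟩ : ∃ s, k' = k * s := ⟨k⁻¹ * k', by group⟩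
    have hs' : s ∈ 𝒮.sub x := by simpa using hs
    change k • a x - (η.1 ![k] (FreeMod.basis π (𝒮.coset k x)) + b k) =
      (k * s) • a x - (η.1 ![k * s] (FreeMod.basis π (𝒮.coset (k * s) x)) + b (k * s))
    rw [𝒮.coset_eq_of_mem hs', hηmul, SubgroupFamily.smul_coset, inv_mul_cancel, mul_smul]
    have h2 : η.1 ![s] (FreeMod.basis π (𝒮.coset 1 x)) + b s = s • a x - a x := by
      rw [← sub_eq_zero, ← neg_eq_zero, ← sub_eq_zero.2 (hη x s hs')]
      abel
    rw [h2, smul_sub]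
    abel
  have hFc : Continuous F := by
    have h1 : Continuous fun p : G × X => (p.1, 𝒮.coset p.1 p.2) :=
      continuous_fst.prodMk 𝒮.continuous_coset
    exact (continuous_fst.smul (ha.comp continuous_snd)).sub
      (((continuous_cochain_one_apply η).comp h1).add (hb.comp continuous_fst))
  let f : LocallyConstant 𝒮.CosetSpace A := ⟨Quotient.lift F hF,
    (IsLocallyConstant.iff_continuous _).2 (continuous_quot_lift _ hFc)⟩
  have hf : ∀ k x, f (𝒮.coset k x) = F (k, x) := fun _ _ => rfl
  obtain ⟨φ, hφ⟩ := FreeMod.exists_chom hA f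
  refine ⟨mem_coboundaries_one.2 ⟨resDelta π _ A φ, fun g => ?_⟩,
    mem_coboundaries_two.2 ⟨fun g => -b g, ((IsLocallyConstant.iff_continuous _).2 hb).neg,
      fun g k => ?_⟩⟩
  · rw [← resDelta_smul, ← map_sub, ← sub_eq_zero]
    change resDelta π _ A (η.1 ![g]) - _ = 0
    rw [← map_sub, resDelta_eq_zero_iff hA]
    have key : ∀ z, (η.1 ![g] - (g • φ - φ)) (FreeMod.basis π z) = -b g := by
      intro z
      obtain ⟨k, x, rfl⟩ := 𝒮.coset_surjective z
      simp only [sub_eq_add_neg, CHom.add_apply, CHom.neg_apply, CHom.smul_apply,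
        FreeMod.smul_basis, hφ, SubgroupFamily.smul_coset, hf, F]
      have h1 := hηmul g (g⁻¹ * k) (𝒮.coset k x)
      rw [mul_inv_cancel_left, SubgroupFamily.smul_coset] at h1
      rw [h1, smul_add, smul_neg, ← mul_smul, mul_inv_cancel_left]
      abel
    intro z z'
    rw [key, key]
  · change _ = g • (-b k) - -b (g * k) + -b g
    rw [hζ, smul_neg]
    abel

/-- Converse to `IsTrivializedBy.mem_coboundaries`. If `κ` on `ℤ_π⟦G/𝒮⟧` extends a homomorphism on
`Δ` whose coboundary is the restriction of `η`, then `η - dκ` takes a constant value `-b(g)` on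
`G/𝒮`, and `a x` is the value of `κ` at `1 S_x`. -/
theorem exists_isTrivializedBy (hA : PiTorsion π A)
    {η : cochains G (HomFree 𝒮 π A) 1} {ζ : cocycles G A 2} (h : Bounds π η ζ)
    (hη : resCochain η ∈ coboundaries G (HomDelta 𝒮 π A) 1)
    (hζ : IsEmpty X → ζ.1 ∈ coboundaries G A 2) :
    ∃ b a, IsTrivializedBy η ζ b a := by
  rcases isEmpty_or_nonempty X with hX | ⟨⟨x₀⟩⟩
  · obtain ⟨b, hb, hbζ⟩ := mem_coboundaries_two.1 (hζ hX)
    refine ⟨fun g => -b g, fun x => hX.elim x, hb.continuous.neg, continuous_of_const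
      fun x => hX.elim x, fun g k => ?_, fun x => hX.elim x⟩
    change -b (g * k) = -b g + g • -b k + _
    rw [hbζ, smul_neg]
    abel
  obtain ⟨κ₀, hκ₀⟩ := mem_coboundaries_one.1 hη
  let z₀ := 𝒮.coset 1 x₀
  obtain ⟨κ, rfl⟩ := resDelta_surjective (π := π) z₀ κ₀
  let b : G → A := fun g => -((η.1 ![g] - (g • κ - κ)) (FreeMod.basis π z₀))
  have hb : ∀ g z, η.1 ![g] (FreeMod.basis π z) =
      -b g + (g • κ (FreeMod.basis π (g⁻¹ • z)) - κ (FreeMod.basis π z)) := by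
    intro g z
    have h1 : resDelta π _ A (η.1 ![g] - (g • κ - κ)) = 0 := by
      rw [map_sub, map_sub, resDelta_smul, ← hκ₀ g]
      exact sub_self _
    have h2 := (resDelta_eq_zero_iff hA _).1 h1 z z₀
    change _ = - -((η.1 ![g] - (g • κ - κ)) (FreeMod.basis π z₀)) + _
    rw [neg_neg, ← h2]
    simp only [sub_eq_add_neg, CHom.add_apply, CHom.neg_apply, CHom.smul_apply,
        FreeMod.smul_basis]
    abel
  have hbη : ∀ g, b g = g • κ (FreeMod.basis π (𝒮.coset g⁻¹ x₀)) - κ (FreeMod.basis π z₀) -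
      η.1 ![g] (FreeMod.basis π z₀) := by
    intro g
    rw [hb g z₀, show g⁻¹ • z₀ = 𝒮.coset g⁻¹ x₀ by rw [SubgroupFamily.smul_coset, mul_one]]
    abel
  clear_value b
  refine ⟨b, fun x => κ (FreeMod.basis π (𝒮.coset 1 x)), ?_, ?_, fun g k => ?_, fun x s hs => ?_⟩
  · rw [funext hbη]
    have h1 : Continuous fun g : G => 𝒮.coset g⁻¹ x₀ :=
      𝒮.continuous_coset.comp (continuous_inv.prodMk continuous_const)
    exact ((continuous_id.smul ((map_continuous κ).comp (FreeMod.continuous_basis.comp h1))).sub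
      continuous_const).sub
      ((continuous_cochain_one_apply η).comp (continuous_id.prodMk continuous_const))
  · exact (map_continuous κ).comp (FreeMod.continuous_basis.comp
      (𝒮.continuous_coset.comp (continuous_const.prodMk continuous_id)))
  · rw [h.apply g k z₀, hb k, hb (g * k), hb g, mul_inv_rev, mul_smul k⁻¹, mul_smul g, smul_add,
      smul_sub, smul_neg]
    abel
  · rw [hb s, SubgroupFamily.inv_smul_coset_one hs]
    abel

end Classes

/-! ### Relative extensions in terms of cochains -/

section Extensions

variable {G X : Type u} [Group G] [TopologicalSpace G] [IsTopologicalGroup G] [CompactSpace G]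
  [TotallyDisconnectedSpace G] [TopologicalSpace X] {𝒮 : SubgroupFamily G X}
  {π : Set Nat.Primes}
  {A : Type u} [AddCommGroup A] [DistribMulAction G A] [TopologicalSpace A]
  [DiscreteTopology A] [ContinuousSMul G A]

namespace RelExtension

variable (R : RelExtension 𝒮 A)

/-- The inclusion of `A`, as a function on the additive group. -/
def incl (a : A) : R.E := R.ext.inl (Multiplicative.ofAdd a)

/-- The projection to `G`. -/
abbrev proj : R.E →* G := R.ext.rightHom

theorem incl_add (a b : A) : R.incl (a + b) = R.incl a * R.incl b := map_mul R.ext.inl _ _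

theorem incl_zero : R.incl 0 = 1 := map_one R.ext.inl

theorem incl_neg (a : A) : R.incl (-a) = (R.incl a)⁻¹ := map_inv R.ext.inl _

theorem incl_injective : Function.Injective R.incl := fun _ _ h => R.ext.inl_injective h

theorem continuous_incl : Continuous R.incl := continuous_of_discreteTopology

theorem proj_incl (a : A) : R.proj (R.incl a) = 1 := R.ext.rightHom_inl _

theorem mul_incl (e : R.E) (a : A) : e * R.incl a = R.incl (R.proj e • a) * e :=
  mul_inv_eq_iff_eq_mul.1 (R.conj e a)

theorem exists_incl_of_proj_eq_one {e : R.E} (h : R.proj e = 1) : ∃ a, R.incl a = e := by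
  have h1 : e ∈ R.ext.rightHom.ker := h
  rw [← R.ext.range_inl_eq_ker_rightHom] at h1
  exact h1

theorem exists_incl_mul {e e' : R.E} (h : R.proj e = R.proj e') : ∃ a, e' = R.incl a * e := by
  obtain ⟨a, ha⟩ := R.exists_incl_of_proj_eq_one (e := e' * e⁻¹)
    (by rw [map_mul, map_inv, h, mul_inv_cancel])
  exact ⟨a, by rw [ha, inv_mul_cancel_right]⟩

theorem isQuotientMap_proj : IsQuotientMap R.proj :=
  R.continuous_rightHom.isClosedMap.isQuotientMap R.continuous_rightHom R.ext.rightHom_surjective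

/-- The homomorphism `q_x : S_x → E`. -/
def qHom (x : X) : 𝒮.sub x →* R.E :=
  MonoidHom.mk' (fun s => R.q ⟨(s.1, x), s.2⟩) fun s t => R.q_mul x s.1 t.1 s.2 t.2

/-- The family of subgroups `q_x(S_x)` of `E`. -/
def qFamily [CompactSpace X] [T2Space X] : SubgroupFamily R.E X where
  sub x := (R.qHom x).range
  isClosed := by
    have h1 : CompactSpace 𝒮.Total := isCompact_iff_compactSpace.1 𝒮.isClosed.isCompact
    have h2 : {ex : R.E × X | ex.1 ∈ (R.qHom ex.2).range} =
        Set.range fun t : 𝒮.Total => (R.q t, t.1.2) := by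
      ext ⟨e, x⟩
      constructor
      · rintro ⟨s, hs⟩
        exact ⟨⟨(s.1, x), s.2⟩, Prod.ext hs rfl⟩
      · rintro ⟨⟨⟨s, y⟩, hs⟩, h⟩
        obtain ⟨rfl, rfl⟩ := Prod.mk.inj h
        exact ⟨⟨s, hs⟩, rfl⟩
    rw [h2]
    exact (isCompact_range (R.continuous_q.prodMk
      (continuous_snd.comp continuous_subtype_val))).isClosed

/-- A relative extension splits if `q` is, up to conjugation by a continuous function `X → A`,
the restriction of a continuous homomorphic section. -/
def Splits : Prop :=
  ∃ (s : G →* R.E) (a : X → A), Continuous s ∧ Continuous a ∧ (∀ g, R.proj (s g) = g) ∧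
    ∀ t : 𝒮.Total, R.incl (a t.1.2) * s t.1.1 * (R.incl (a t.1.2))⁻¹ = R.q t

variable {R} in
theorem Equivalent.splits_iff {R' : RelExtension 𝒮 A} (h : R.Equivalent R') :
    R.Splits ↔ R'.Splits := by
  obtain ⟨f, hf, c, hc, hq⟩ := h
  have hincl : ∀ a, f (R.incl a) = R'.incl a := fun a => f.map_inl _
  have hproj : ∀ e, R'.proj (f e) = R.proj e := fun e => f.rightHom_map e
  constructor
  · rintro ⟨s, a, hs, ha, hps, hsq⟩
    refine ⟨(f : R.E ≃* R'.E).toMonoidHom.comp s, fun x => c x + a x, hf.comp hs, hc.add ha,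
      fun g => (hproj _).trans (hps g), fun t => ?_⟩
    rw [hq, ← hsq t, map_mul, map_mul, map_inv, hincl, incl_add, mul_inv_rev]
    change R'.incl _ * _ * f (s t.1.1) * _ = R'.incl _ * _ * (R'.incl _)⁻¹
    simp only [mul_assoc]
  · rintro ⟨s, a, hs, ha, hps, hsq⟩
    have hfsymm : Continuous f.symm :=
      Continuous.continuous_symm_of_equiv_compact_to_t2 (f := (f : R.E ≃* R'.E).toEquiv) hf
    have hsf : ∀ e, f (f.symm e) = e := fun e => (f : R.E ≃* R'.E).apply_symm_apply e
    refine ⟨(f.symm : R'.E ≃* R.E).toMonoidHom.comp s, fun x => -c x + a x, hfsymm.comp hs,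
      hc.neg.add ha, fun g => ?_, fun t => ?_⟩
    · change R.proj (f.symm (s g)) = g
      rw [← hproj, hsf, hps]
    · apply (f : R.E ≃* R'.E).injective
      change f (_ * f.symm (s t.1.1) * _) = f _
      have h1 := hq t
      rw [← hsq t] at h1
      change _ = R'.incl _ * _ * (R'.incl _)⁻¹ at h1
      rw [map_mul, map_mul, map_inv, hsf, hincl, incl_add, incl_neg, mul_inv_rev, inv_inv]
      have h2 : f (R.q t) = (R'.incl (c t.1.2))⁻¹ *
          (R'.incl (a t.1.2) * s t.1.1 * (R'.incl (a t.1.2))⁻¹) * R'.incl (c t.1.2) := by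
        rw [h1]; group
      rw [h2]; group

variable [Finite A] {η : cochains G (HomFree 𝒮 π A) 1} {ζ : cocycles G A 2} (h : Bounds π η ζ)

theorem conj_cocycleExt (a b : A) (g : G) :
    (⟨a - ζ.1 ![1, 1], 1⟩ : CocycleExt ζ) * ⟨b, g⟩ * (⟨a - ζ.1 ![1, 1], 1⟩ : CocycleExt ζ)⁻¹ =
      ⟨a + b - g • a, g⟩ := by
  rw [mul_inv_eq_iff_eq_mul]
  refine CocycleExt.ext ?_ ((one_mul g).trans (mul_one g).symm)
  rw [CocycleExt.fst_mul, CocycleExt.fst_mul]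
  change a - _ + (1 : G) • b + ζ.1 ![1, g] = a + b - g • a + g • (a - _) + ζ.1 ![g, 1]
  rw [CocycleExt.cocycle_one_left ζ g, CocycleExt.cocycle_one_right ζ g, one_smul, smul_sub]
  abel

theorem ofCochains_splits_iff : (ofCochains η ζ h).Splits ↔ ∃ b a, IsTrivializedBy η ζ b a := by
  constructor
  · rintro ⟨s, a, hs, ha, hps, hsq⟩
    let s' : G →* CocycleExt ζ := s
    have hsnd : ∀ g, (s' g).snd = g := hps
    refine ⟨fun g => (s' g).fst, a, CocycleExt.continuous_fst.comp hs, ha, fun g k => ?_,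
      fun x t ht => ?_⟩
    · have h1 := congrArg CocycleExt.fst (map_mul s' g k)
      rw [CocycleExt.fst_mul, hsnd, hsnd] at h1
      exact h1
    · have h1 : (⟨a x - ζ.1 ![1, 1], 1⟩ : CocycleExt ζ) * s' t *
          (⟨a x - ζ.1 ![1, 1], 1⟩ : CocycleExt ζ)⁻¹ =
          ⟨-(η.1 ![t] (FreeMod.basis π (𝒮.coset 1 x))), t⟩ := hsq ⟨(t, x), ht⟩
      have h2 : s' t = ⟨(s' t).fst, t⟩ := CocycleExt.ext rfl (hsnd t)
      rw [h2, conj_cocycleExt] at h1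
      exact (congrArg CocycleExt.fst h1).symm
  · rintro ⟨b, a, hb, ha, hζ, hη⟩
    let s : G →* CocycleExt ζ := MonoidHom.mk' (fun g => ⟨b g, g⟩) fun g k =>
      CocycleExt.ext (hζ g k) rfl
    refine ⟨s, a, CocycleExt.continuous_mk hb continuous_id, ha, fun g => rfl, fun t => ?_⟩
    have h1 := conj_cocycleExt (ζ := ζ) (a t.1.2) (b t.1.1) t.1.1
    rw [← hη t.1.2 t.1.1 t.2] at h1
    exact h1

/-- An equivalence from `R` to the extension defined by `ζ` is a function `r` on `R.E`, giving the
`A`-component. -/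
theorem equivalent_ofCochains_iff : R.Equivalent (ofCochains η ζ h) ↔
    ∃ (r : R.E → A) (a : X → A), Continuous r ∧ Continuous a ∧
      (∀ c, r (R.incl c) = c - ζ.1 ![1, 1]) ∧
      (∀ e e', r (e * e') = r e + R.proj e • r e' + ζ.1 ![R.proj e, R.proj e']) ∧
      ∀ t : 𝒮.Total, -(η.1 ![t.1.1] (FreeMod.basis π (𝒮.coset 1 t.1.2))) =
        a t.1.2 + r (R.q t) - t.1.1 • a t.1.2 := by
  constructor
  · rintro ⟨f, hf, a, ha, hq⟩
    let f' : R.E →* CocycleExt ζ := (f : R.E ≃* (ofCochains η ζ h).E).toMonoidHom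
    have hsnd : ∀ e, (f' e).snd = R.proj e := fun e => f.rightHom_map e
    refine ⟨fun e => (f' e).fst, a, CocycleExt.continuous_fst.comp hf, ha, fun c => ?_,
      fun e e' => ?_, fun t => ?_⟩
    · exact congrArg (CocycleExt.fst (ζ := ζ)) (f.map_inl (Multiplicative.ofAdd c))
    · have h1 := congrArg CocycleExt.fst (map_mul f' e e')
      rw [CocycleExt.fst_mul, hsnd, hsnd] at h1
      exact h1
    · have h1 : (⟨-(η.1 ![t.1.1] (FreeMod.basis π (𝒮.coset 1 t.1.2))), t.1.1⟩ : CocycleExt ζ) =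
          ⟨a t.1.2 - ζ.1 ![1, 1], 1⟩ * f' (R.q t) *
          (⟨a t.1.2 - ζ.1 ![1, 1], 1⟩ : CocycleExt ζ)⁻¹ := hq t
      have h2 : f' (R.q t) = ⟨(f' (R.q t)).fst, t.1.1⟩ :=
        CocycleExt.ext rfl ((hsnd _).trans (R.rightHom_q t))
      rw [h2, conj_cocycleExt] at h1
      exact congrArg CocycleExt.fst h1
  · rintro ⟨r, a, hr, ha, hri, hrm, hq⟩
    let f : R.E →* CocycleExt ζ := MonoidHom.mk' (fun e => ⟨r e, R.proj e⟩) fun e e' =>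
      CocycleExt.ext (hrm e e') (map_mul R.proj e e')
    let f' : R.E →* (ofCochains η ζ h).E := f
    have hf' : Continuous f' := CocycleExt.continuous_mk hr R.continuous_rightHom
    refine ⟨GroupExtension.Equiv.ofMonoidHom f' ?_ ?_, hf', a, ha, fun t => ?_⟩
    · ext c
      exact CocycleExt.ext (ζ := ζ) (hri _) (R.proj_incl _)
    · ext e
      rfl
    · have h1 := conj_cocycleExt (ζ := ζ) (a t.1.2) (r (R.q t)) t.1.1
      rw [← hq t] at h1
      have h2 : f (R.q t) = ⟨r (R.q t), t.1.1⟩ := CocycleExt.ext rfl (R.rightHom_q t)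
      rw [← h2] at h1
      exact h1.symm

/-- Two descriptions of a relative extension by cochains differ by a trivialized pair. -/
theorem exists_isTrivializedBy_sub [CompactSpace X]
    {η' : cochains G (HomFree 𝒮 π A) 1} {ζ' : cocycles G A 2} (h' : Bounds π η' ζ')
    (hR : R.Equivalent (ofCochains η ζ h)) (hR' : R.Equivalent (ofCochains η' ζ' h')) :
    ∃ b a, IsTrivializedBy (η - η') (ζ - ζ') b a := by
  obtain ⟨r, a, hr, ha, hri, hrm, hq⟩ := (R.equivalent_ofCochains_iff h).1 hR
  obtain ⟨r', a', hr', ha', hri', hrm', hq'⟩ := (R.equivalent_ofCochains_iff h').1 hR'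
  have hinv : ∀ e e', R.proj e = R.proj e' → r e' - r' e' = r e - r' e := by
    intro e e' hee
    obtain ⟨c, rfl⟩ := R.exists_incl_mul hee
    rw [hrm, hrm', hri, hri', R.proj_incl, one_smul, one_smul,
      CocycleExt.cocycle_one_left ζ (R.proj e), CocycleExt.cocycle_one_left ζ' (R.proj e)]
    abel
  choose l hl using R.ext.rightHom_surjective
  have hb : ∀ e, r (l (R.proj e)) - r' (l (R.proj e)) = r e - r' e := fun e =>
    hinv _ _ (hl _).symm
  -- minus the difference of the two `A`-components descends to `G`
  refine ⟨fun g => r (l g) - r' (l g), fun x => a x - a' x, ?_, ha.sub ha', fun g k => ?_,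
    fun x s hs => ?_⟩
  · rw [R.isQuotientMap_proj.continuous_iff]
    exact (hr.sub hr').congr fun e => (hb e).symm
  · have h1 := hinv (l g * l k) (l (g * k)) 
      (by rw [map_mul]; exact (congrArg₂ _ (hl g) (hl k)).trans (hl _).symm)
    change r (l (g * k)) - r' (l (g * k)) = r (l g) - r' (l g) + g • (r (l k) - r' (l k)) +
      (ζ.1 ![g, k] - ζ'.1 ![g, k])
    rw [h1, hrm, hrm', show R.proj (l g) = g from hl g, show R.proj (l k) = k from hl k, smul_sub]
    abel
  · have h1 := hb (R.q ⟨(s, x), hs⟩)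
    rw [show R.proj (R.q ⟨(s, x), hs⟩) = s from R.rightHom_q _] at h1
    have h2 := hq ⟨(s, x), hs⟩
    have h3 := hq' ⟨(s, x), hs⟩
    dsimp only at h2 h3 ⊢
    rw [h1]
    change -((η.1 ![s] - η'.1 ![s] : HomFree 𝒮 π A) _) = _
    rw [sub_eq_add_neg, CHom.add_apply, CHom.neg_apply, neg_add, h2, neg_neg,
      ← neg_neg (η'.1 ![s] _), h3, smul_sub]
    abel

variable [CompactSpace X] [T2Space X] [TotallyDisconnectedSpace X]

/-- The projection to `G` has a continuous section `s`, and `r` gives the `A`-component of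
`e = r(e) s(p(e))`. -/
theorem exists_continuous_section : ∃ (r : R.E → A) (s : G → R.E), Continuous r ∧ Continuous s ∧
    (∀ a e, r (R.incl a * e) = a + r e) ∧ (∀ g, R.proj (s g) = g) ∧ (∀ g, r (s g) = 0) ∧
    ∀ e, R.incl (r e) * s (R.proj e) = e := by
  let T : SubgroupFamily R.E PUnit.{u + 1} :=
    ⟨fun _ => ⊥, isClosed_singleton.preimage continuous_fst⟩
  obtain ⟨r₀, hr, hra, -⟩ := exists_continuous_retraction R.ext.inl R.ext.inl_injective
    inferInstance T fun _ _ h => h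
  let r : R.E → A := fun e => r₀ e ⟨⟩
  have hr : Continuous r := hr.comp (continuous_id.prodMk continuous_const)
  have hra : ∀ a e, r (R.incl a * e) = a + r e := fun a e => hra a e _
  choose l hl using R.ext.rightHom_surjective
  let s : G → R.E := fun g => R.incl (-r (l g)) * l g
  have hs : ∀ e, s (R.proj e) = R.incl (-r e) * e := by
    intro e
    obtain ⟨c, hc⟩ := R.exists_incl_mul (e := e) (e' := l (R.proj e)) (hl _).symm
    change R.incl (-r (l (R.proj e))) * l (R.proj e) = _
    rw [hc, hra, ← mul_assoc, ← incl_add]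
    congr 2
    abel
  refine ⟨r, s, hr, ?_, hra, fun g => ?_, fun g => ?_, fun e => ?_⟩
  · rw [R.isQuotientMap_proj.continuous_iff]
    exact ((R.continuous_incl.comp hr.neg).mul continuous_id).congr fun e => (hs e).symm
  · change R.proj (R.incl _ * _) = g
    rw [map_mul, proj_incl, one_mul]
    exact hl g
  · change r (R.incl _ * _) = 0
    rw [hra, neg_add_cancel]
  · rw [hs, incl_neg, mul_inv_cancel_left]

/-- Every relative extension is given by cochains. The cocycle `ζ` comes from a continuous section
`s`. With `r'` a trivialization of the `A`-torsor `⨆ E / q_x(S_x) → G/𝒮`, the cochain `η` is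
`η(g)(p(e) S_x) = r'(e, x) - g r'(s(g)⁻¹ e, x)`. -/
theorem exists_equivalent_ofCochains (hA : PiTorsion π A) :
    ∃ (η : cochains G (HomFree 𝒮 π A) 1) (ζ : cocycles G A 2) (h : Bounds π η ζ),
      R.Equivalent (ofCochains η ζ h) := by
  obtain ⟨r, s, hr, hs, hra, hps, hrs, hrse⟩ := R.exists_continuous_section
  obtain ⟨r', hr', hra', hrq'⟩ := exists_continuous_retraction R.ext.inl R.ext.inl_injective
    inferInstance R.qFamily (by
      rintro x a ⟨t, ht⟩
      have h1 : R.proj (R.q ⟨(t.1, x), t.2⟩) = t := R.rightHom_q _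
      rw [show R.q ⟨(t.1, x), t.2⟩ = R.ext.inl a from ht, show R.proj (R.ext.inl a) = 1 from
        R.ext.rightHom_inl a] at h1
      rw [← ht, Subtype.ext (a1 := t) (a2 := 1) h1.symm, map_one])
  have hra' : ∀ a e x, r' (R.incl a * e) x = a + r' e x := hra'
  have hrq' : ∀ e x t (ht : t ∈ 𝒮.sub x), r' (e * R.q ⟨(t, x), ht⟩) x = r' e x :=
    fun e x t ht => hrq' e _ x ⟨⟨t, ht⟩, rfl⟩
  -- multiplication in `E` in terms of the section
  have hss : ∀ g k, R.incl (r (s g * s k)) * s (g * k) = s g * s k := by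
    intro g k
    have h1 := hrse (s g * s k)
    rwa [map_mul, hps, hps] at h1
  have hmul : ∀ e e', r (e * e') = r e + R.proj e • r e' +
      r (s (R.proj e) * s (R.proj e')) := by
    intro e e'
    conv_lhs => rw [← hrse e, ← hrse e']
    rw [mul_assoc, ← mul_assoc (s _), mul_incl, hps, mul_assoc, hra, hra, add_assoc]
  let ζ₀ : (Fin 2 → G) → A := fun v => r (s (v 0) * s (v 1))
  have hζ : ζ₀ ∈ cocycles G A 2 := by
    refine mem_cocycles_two.2 ⟨(IsLocallyConstant.iff_continuous _).2 (hr.comp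
      ((hs.comp (continuous_apply 0)).mul (hs.comp (continuous_apply 1)))), fun g h k => ?_⟩
    have h1 := hmul (s g) (s h * s k)
    have h2 := hmul (s g * s h) (s k)
    rw [map_mul, hps, hps, hps, hrs] at h1 h2
    rw [smul_zero] at h2
    rw [mul_assoc, h1] at h2
    change g • r (s h * s k) - r (s (g * h) * s k) + r (s g * s (h * k)) - r (s g * s h) = 0
    rw [← sub_eq_zero] at h2
    rw [← h2]
    abel
  -- `D g e x` depends only on the coset `p(e) S_x`, where it is the value of `η(g)`
  let D : G → R.E → X → A := fun g e x => r' e x - g • r' ((s g)⁻¹ * e) x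
  have hDa : ∀ g a e x, D g (R.incl a * e) x = D g e x := by
    intro g a e x
    have h1 : (s g)⁻¹ * (R.incl a * e) = R.incl (g⁻¹ • a) * ((s g)⁻¹ * e) := by
      rw [← mul_assoc, mul_incl, map_inv, hps, mul_assoc]
    change _ - _ = _ - _
    rw [h1, hra', hra', smul_add, smul_inv_smul]
    abel
  have hDq : ∀ g e x t (ht : t ∈ 𝒮.sub x), D g (e * R.q ⟨(t, x), ht⟩) x = D g e x := by
    intro g e x t ht
    change _ - _ = _ - _
    rw [← mul_assoc, hrq', hrq']
  have hDeq : ∀ g e e' x t, t ∈ 𝒮.sub x → R.proj e' = R.proj e * t → D g e' x = D g e x := by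
    intro g e e' x t ht h
    obtain ⟨a, rfl⟩ := R.exists_incl_mul (e := e * R.q ⟨(t, x), ht⟩) (e' := e')
      (by rw [h, map_mul]; exact congrArg _ (R.rightHom_q _))
    rw [hDa, hDq]
  let F : G → G × X → A := fun g p => D g (s p.1) p.2
  have hFc : Continuous fun q : G × (G × X) => F q.1 q.2 := by
    have c1 : Continuous fun q : G × (G × X) => s q.1 := hs.comp continuous_fst
    have c2 : Continuous fun q : G × (G × X) => s q.2.1 :=
      hs.comp (continuous_fst.comp continuous_snd)
    have c3 : Continuous fun q : G × (G × X) => q.2.2 := continuous_snd.comp continuous_snd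
    exact (hr'.comp (c2.prodMk c3)).sub
      (continuous_fst.smul (hr'.comp ((c1.inv.mul c2).prodMk c3)))
  have hFrel : ∀ g p p', 𝒮.cosetSetoid p p' → F g p = F g p' := by
    rintro g ⟨k, x⟩ ⟨k', x'⟩ ⟨hx, ht⟩
    obtain rfl : x = x' := hx
    exact (hDeq g _ _ x _ ht (by rw [hps, hps]; group)).symm
  let f : G → LocallyConstant 𝒮.CosetSpace A := fun g => ⟨Quotient.lift (F g) (hFrel g),
    (IsLocallyConstant.iff_continuous _).2 (continuous_quot_lift _
      (hFc.comp (continuous_const.prodMk continuous_id)))⟩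
  have hf : ∀ g e x, f g (𝒮.coset (R.proj e) x) = D g e x := fun g e x =>
    hDeq g e _ x 1 (one_mem _) (by rw [hps, mul_one])
  have hfc : IsLocallyConstant f := by
    rw [IsLocallyConstant.iff_eventually_eq]
    intro g
    filter_upwards [(isLocallyConstant_curry hFc).eventually_eq g] with g' hg'
    refine LocallyConstant.ext fun z => ?_
    obtain ⟨k, x, rfl⟩ := 𝒮.coset_surjective z
    exact congrFun hg' (k, x)
  choose Φ hΦ using FreeMod.exists_chom (Z := 𝒮.CosetSpace) hA
  let η : cochains G (HomFree 𝒮 π A) 1 :=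
    ⟨fun v => Φ (f (v 0)), (hfc.comp Φ).comp_continuous (continuous_apply 0)⟩
  have hη : ∀ g e x, η.1 ![g] (FreeMod.basis π (𝒮.coset (R.proj e) x)) = D g e x := by
    intro g e x
    rw [← hf]
    exact hΦ _ _
  have hbounds : Bounds π η ⟨ζ₀, hζ⟩ := by
    rw [bounds_iff]
    intro g k z
    obtain ⟨m, x, rfl⟩ := 𝒮.coset_surjective z
    obtain ⟨e, rfl⟩ := R.ext.rightHom_surjective m
    have h1 : g⁻¹ • 𝒮.coset (R.proj e) x = 𝒮.coset (R.proj ((s g)⁻¹ * e)) x := by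
      rw [SubgroupFamily.smul_coset, map_mul, map_inv, hps]
    rw [h1, hη, hη, hη]
    -- `s(g) s(k) = ζ(g, k) s(gk)` makes `ζ` the coboundary of `η`
    have h2 : (s (g * k))⁻¹ * e =
        R.incl ((g * k)⁻¹ • r (s g * s k)) * ((s k)⁻¹ * ((s g)⁻¹ * e)) := by
      have h3 : (s k)⁻¹ * ((s g)⁻¹ * e) = (s g * s k)⁻¹ * e := by group
      have h4 := R.mul_incl (s (g * k))⁻¹ (r (s g * s k))
      rw [map_inv, hps] at h4
      have h5 := hss g k
      generalize r (s g * s k) = c at h4 h5 ⊢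
      rw [h3, ← h5, mul_inv_rev (R.incl c), mul_assoc (s (g * k))⁻¹, ← mul_assoc (R.incl _), ← h4]
      group
    change r (s g * s k) = g • (r' _ x - k • r' _ x) - (r' _ x - (g * k) • r' _ x) +
      (r' _ x - g • r' _ x)
    rw [h2, hra', smul_add, smul_inv_smul, smul_sub, mul_smul]
    abel
  refine ⟨η, ⟨ζ₀, hζ⟩, hbounds, (R.equivalent_ofCochains_iff hbounds).2
    ⟨r, fun x => -r' 1 x, hr, ?_, fun c => ?_, hmul, ?_⟩⟩
  · exact (hr'.comp (continuous_const.prodMk continuous_id)).neg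
  · change r (R.incl c) = c - r (s 1 * s 1)
    have h1 := hra c 1
    have h2 := hra (-r 1) (s 1)
    have h3 := hrse 1
    rw [map_one] at h3
    rw [incl_neg, ← eq_inv_of_mul_eq_one_right h3, hrs] at h2
    rw [mul_one] at h1
    rw [h1, h2]
    abel
  · rintro ⟨⟨t, x⟩, ht⟩
    have ht' : R.proj (R.q ⟨(t, x), ht⟩) = t := R.rightHom_q _
    have h1 : 𝒮.coset 1 x = 𝒮.coset (R.proj (R.q ⟨(t, x), ht⟩)) x := by
      rw [ht']
      simpa using (𝒮.coset_eq_of_mem ht 1).symm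
    change -(η.1 ![t] (FreeMod.basis π (𝒮.coset 1 x))) =
      -r' 1 x + r (R.q ⟨(t, x), ht⟩) - t • -r' 1 x
    rw [h1, hη]
    have h2 : (s t)⁻¹ * R.q ⟨(t, x), ht⟩ = R.incl (t⁻¹ • r (R.q ⟨(t, x), ht⟩)) := by
      have h3 := hrse (R.q ⟨(t, x), ht⟩)
      rw [ht'] at h3
      rw [inv_mul_eq_iff_eq_mul, mul_incl, hps, smul_inv_smul, h3]
    have h4 := hra' (t⁻¹ • r (R.q ⟨(t, x), ht⟩)) 1 x
    have h5 := hrq' 1 x t ht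
    rw [mul_one] at h4
    rw [one_mul] at h5
    change -(r' _ x - t • r' _ x) = _
    rw [h2, h4, h5, smul_add, smul_inv_smul, smul_neg]
    abel

end RelExtension

end Extensions

/-! ### The class of a relative extension and lifting problems -/

section Represent

variable {G X : Type u} [Group G] [TopologicalSpace G] [IsTopologicalGroup G] [CompactSpace G]
  [TotallyDisconnectedSpace G] [TopologicalSpace X] [CompactSpace X] [T2Space X]
  [TotallyDisconnectedSpace X] {𝒮 : SubgroupFamily G X} {π : Set Nat.Primes}
  {A : Type u} [AddCommGroup A] [DistribMulAction G A] [TopologicalSpace A]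
  [DiscreteTopology A] [ContinuousSMul G A]

theorem RelExtension.existsUnique_represents [Finite A] (hA : PiTorsion π A)
    (R : RelExtension 𝒮 A) : ∃! c : relCohomologySucc 𝒮 π A 1, R.Represents π c := by
  obtain ⟨η, ζ, h, hR⟩ := R.exists_equivalent_ofCochains hA
  obtain ⟨c, hc⟩ := h.exists_isClassOf hA
  refine ⟨c, R.represents_iff.2 ⟨η, ζ, h, hc, hR⟩, fun c' hc' => ?_⟩
  obtain ⟨η', ζ', h', hc', hR'⟩ := R.represents_iff.1 hc'
  obtain ⟨b, a, hab⟩ := R.exists_isTrivializedBy_sub h' h hR' hR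
  obtain ⟨h1, h2⟩ := hab.mem_coboundaries hA (h'.sub h)
  exact sub_eq_zero.1 ((hc'.sub hc).eq_zero_iff.2 ⟨h1, fun _ => h2⟩)

theorem RelExtension.splits_iff_represents_zero [Finite A] (hA : PiTorsion π A)
    (R : RelExtension 𝒮 A) : R.Splits ↔ R.Represents π 0 := by
  constructor
  · intro hs
    obtain ⟨η, ζ, h, hR⟩ := R.exists_equivalent_ofCochains hA
    obtain ⟨c, hc⟩ := h.exists_isClassOf hA
    obtain ⟨b, a, hab⟩ := (ofCochains_splits_iff h).1 (hR.splits_iff.1 hs)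
    obtain ⟨h1, h2⟩ := hab.mem_coboundaries hA h
    obtain rfl := hc.eq_zero_iff.2 ⟨h1, fun _ => h2⟩
    exact R.represents_iff.2 ⟨η, ζ, h, hc, hR⟩
  · intro h0
    obtain ⟨η, ζ, h, hc, hR⟩ := R.represents_iff.1 h0
    obtain ⟨h1, h2⟩ := hc.eq_zero_iff.1 rfl
    exact hR.splits_iff.2 ((ofCochains_splits_iff h).2 (exists_isTrivializedBy hA h h1 h2))

theorem LiftingProblem.hasSolution_iff_splits {C : FiniteGroupVariety}
    (P : LiftingProblem C 𝒮) [P.FiniteAbelianKernel] : P.HasSolution ↔ P.pullback.Splits := by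
  constructor
  · rintro ⟨φ', c, hφ', hc, hα, hσ⟩
    let s : G →* P.pullbackGroup := MonoidHom.mk' (fun g => ⟨(g, φ' g), (hα g).symm⟩)
      fun g k => Subtype.ext (Prod.ext rfl (map_mul φ' g k))
    refine ⟨s, fun x => Additive.ofMul (c x), Continuous.subtype_mk
      (continuous_id.prodMk hφ') _, hc, fun g => rfl, fun t => ?_⟩
    refine Subtype.ext (p := (· ∈ P.pullbackGroup)) (Prod.ext ?_ (hσ t))
    change 1 * t.1.1 * 1⁻¹ = t.1.1
    simp
  · rintro ⟨s, a, hs, ha, hps, hsq⟩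
    let s' : G →* P.pullbackGroup := s
    have hs'c : Continuous s' := hs
    have hfst : ∀ g, (s' g).1.1 = g := hps
    refine ⟨((MonoidHom.snd G P.H).comp P.pullbackGroup.subtype).comp s',
      fun x => Additive.toMul (α := P.α.ker) (a x),
      continuous_snd.comp (continuous_subtype_val.comp hs'c), ha, fun g => ?_, fun t => ?_⟩
    · have h1 := P.mem_pullbackGroup.1 (s' g).2
      rw [hfst] at h1
      exact h1.symm
    · exact congrArg (fun e : P.pullbackGroup => e.1.2) (hsq t)

end Represent

/-! ### Varieties of finite groups -/

namespace FiniteGroupVariety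

variable {C : FiniteGroupVariety}

theorem mem_of_contains {Γ : Type} [Group Γ] (h : C.Contains Γ) : C.Mem Γ := by
  obtain ⟨Γ₀, _, h₀, ⟨e⟩⟩ := h
  exact C.of_equiv _ _ e.symm h₀

theorem Contains.of_mulEquiv {Γ Γ' : Type*} [Group Γ] [Group Γ'] (h : C.Contains Γ)
    (e : Γ ≃* Γ') : C.Contains Γ' := by
  obtain ⟨Γ₀, _, h₀, ⟨e₀⟩⟩ := h
  exact ⟨Γ₀, _, h₀, ⟨e.symm.trans e₀⟩⟩

theorem Contains.finite {Γ : Type*} [Group Γ] (h : C.Contains Γ) : Finite Γ := by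
  obtain ⟨Γ₀, _, h₀, ⟨e⟩⟩ := h
  have := C.finite Γ₀ h₀
  exact Finite.of_equiv _ e.symm.toEquiv

theorem Contains.mem_primes {Γ : Type*} [Group Γ] (h : C.Contains Γ) {p : Nat.Primes}
    (hp : (p : ℕ) ∣ Nat.card Γ) : p ∈ C.primes := by
  obtain ⟨Γ₀, _, h₀, ⟨e⟩⟩ := h
  exact ⟨Γ₀, _, h₀, Nat.card_congr e.toEquiv ▸ hp⟩

/-- In a pro-`𝒞` group, the orders of the torsion elements involve only primes in `π(𝒞)`. -/
theorem IsPro.mem_primes {H : Type*} [Group H] [TopologicalSpace H] [IsTopologicalGroup H]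
    [CompactSpace H] [TotallyDisconnectedSpace H] (hH : C.IsPro H) {h : H} (hh : IsOfFinOrder h)
    {p : Nat.Primes} (hp : (p : ℕ) ∣ orderOf h) : p ∈ C.primes := by
  have hb := orderOf_pow_orderOf_div hh.orderOf_pos.ne' hp
  set b := h ^ (orderOf h / p)
  have hb1 : b ≠ 1 := by
    intro h1
    rw [h1, orderOf_one] at hb
    exact p.2.one_lt.ne hb
  obtain ⟨N, hN⟩ := ProfiniteGrp.exist_openNormalSubgroup_sub_open_nhds_of_one
    (isOpen_compl_singleton (x := b)) (by simpa using hb1.symm)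
  have hbN : b ∉ N.toSubgroup := fun h => hN h rfl
  have hC : C.Contains (H ⧸ N.toSubgroup) := hH _ N.isOpen'
  refine hC.mem_primes ?_
  have : orderOf (b : H ⧸ N.toSubgroup) = p := by
    refine orderOf_eq_prime ?_ ?_
    · rw [← QuotientGroup.mk_pow, ← hb, pow_orderOf_eq_one, QuotientGroup.mk_one]
    · rwa [Ne, QuotientGroup.eq_one_iff]
  rw [← this]
  exact orderOf_dvd_natCard _

theorem Contains.of_surjective (hC : C.ExtensionClosed) {Γ Γ' : Type*} [Group Γ] [Group Γ']
    (f : Γ →* Γ') (hf : Function.Surjective f) (hker : C.Contains f.ker) (h : C.Contains Γ') :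
    C.Contains Γ := by
  have := h.finite
  have := hker.finite
  have : Finite Γ := by
    have h1 : Finite (Γ ⧸ f.ker) :=
      Finite.of_equiv _ (QuotientGroup.quotientKerEquivOfSurjective f hf).symm.toEquiv
    exact Finite.of_equiv _ (Subgroup.groupEquivQuotientProdSubgroup (s := f.ker)).symm
  let e : Shrink.{0} Γ ≃* Γ := Shrink.mulEquiv
  let f₀ : Shrink.{0} Γ →* Γ' := f.comp e.toMonoidHom
  have hf₀ : Function.Surjective f₀ := hf.comp e.surjective
  have e₁ : f.ker ≃* f₀.ker :=
    (e.symm.subgroupMap f.ker).trans (MulEquiv.subgroupCongr (by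
      ext x
      constructor
      · rintro ⟨y, hy, rfl⟩
        change f (e (e.symm y)) = 1
        rw [e.apply_symm_apply]
        exact hy
      · intro hx
        exact ⟨e x, hx, e.symm_apply_apply x⟩))
  exact ⟨Shrink.{0} Γ, inferInstance, hC _ f₀.ker (mem_of_contains (hker.of_mulEquiv e₁))
    (mem_of_contains (h.of_mulEquiv (QuotientGroup.quotientKerEquivOfSurjective f₀ hf₀).symm)),
    ⟨e.symm⟩⟩

theorem contains_of_card_prime {p : Nat.Primes} (hp : p ∈ C.primes) {Γ : Type*} [Group Γ]
    (h : Nat.card Γ = p) : C.Contains Γ := by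
  obtain ⟨Γ₀, _, h₀, hdvd⟩ := hp
  have := C.finite Γ₀ h₀
  obtain ⟨g, hg⟩ := exists_prime_orderOf_dvd_card' (p : ℕ) hdvd
  exact ⟨Subgroup.zpowers g, inferInstance, C.subgroup _ _ h₀,
    ⟨mulEquivOfPrimeCardEq (p := (p : ℕ)) h ((Nat.card_zpowers g).trans hg)⟩⟩

theorem contains_of_isPGroup (hC : C.ExtensionClosed) {p : Nat.Primes} (hp : p ∈ C.primes)
    {Γ : Type*} [Group Γ] [Finite Γ] (h : IsPGroup (p : ℕ) Γ) : C.Contains Γ := by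
  induction hn : Nat.card Γ using Nat.strong_induction_on generalizing Γ with
  | _ n ih =>
    subst hn
    rcases subsingleton_or_nontrivial Γ with hs | hs
    · exact ⟨PUnit, inferInstance, C.trivial,
        ⟨{ toFun := fun _ => 1, invFun := fun _ => 1, left_inv := fun _ => Subsingleton.elim _ _,
           right_inv := fun _ => rfl, map_mul' := fun _ _ => rfl }⟩⟩
    have hcen := h.center_nontrivial
    obtain ⟨z, hz⟩ : ∃ z : Subgroup.center Γ, orderOf z = p :=
      exists_prime_orderOf_dvd_card' (p : ℕ)
        (((h.to_subgroup _).card_eq_or_dvd).resolve_left Finite.one_lt_card.ne')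
    have hz' : orderOf (z : Γ) = p := by rw [Subgroup.orderOf_coe, hz]
    let N := Subgroup.zpowers (z : Γ)
    have hNcard : Nat.card N = p := (Nat.card_zpowers _).trans hz'
    have hN : N.Normal := by
      have hle : N ≤ Subgroup.center Γ := by
        rw [Subgroup.zpowers_le]; exact z.2
      exact ⟨fun n hn g => by
        rw [(Subgroup.mem_center_iff.1 (hle hn) g), mul_inv_cancel_right]; exact hn⟩
    refine Contains.of_surjective hC (QuotientGroup.mk' N) (QuotientGroup.mk'_surjective N) ?_ ?_
    · exact contains_of_card_prime hp (by rw [QuotientGroup.ker_mk', hNcard])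
    · refine ih _ ?_ (h.to_quotient N) rfl
      rw [Subgroup.card_eq_card_quotient_mul_card_subgroup N, hNcard]
      exact lt_mul_of_one_lt_right Nat.card_pos p.2.one_lt

end FiniteGroupVariety

/-! ### Change of coefficients -/

section Coefficients

variable {G X : Type u} [Group G] [TopologicalSpace G] [IsTopologicalGroup G] [CompactSpace G]
  [TotallyDisconnectedSpace G] [TopologicalSpace X] [CompactSpace X] {𝒮 : SubgroupFamily G X}
  {π : Set Nat.Primes}
  {A : Type u} [AddCommGroup A] [DistribMulAction G A] [TopologicalSpace A]
  [DiscreteTopology A] [ContinuousSMul G A]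

/-- A `G`-stable subgroup of `A`, as a discrete `G`-module. -/
def StableSub (S : AddSubgroup A) (_ : ∀ (g : G), ∀ a ∈ S, g • a ∈ S) : Type u := S

namespace StableSub

variable {S : AddSubgroup A} {hS : ∀ (g : G), ∀ a ∈ S, g • a ∈ S}

instance : AddCommGroup (StableSub S hS) := inferInstanceAs (AddCommGroup S)

instance : TopologicalSpace (StableSub S hS) := inferInstanceAs (TopologicalSpace S)

instance : DiscreteTopology (StableSub S hS) := inferInstanceAs (DiscreteTopology S)

variable (S hS) in
/-- The inclusion into the ambient module. -/
def incl : StableSub S hS →+ A := S.subtype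

theorem incl_injective : Function.Injective (incl S hS) := Subtype.val_injective

theorem incl_mem (a : StableSub S hS) : incl S hS a ∈ S := Subtype.prop (p := (· ∈ S)) a

instance : DistribMulAction G (StableSub S hS) where
  smul g a := (⟨g • incl S hS a, hS g _ (incl_mem a)⟩ : S)
  one_smul a := Subtype.ext (one_smul G (incl S hS a))
  mul_smul g h a := Subtype.ext (mul_smul g h (incl S hS a))
  smul_zero g := Subtype.ext (smul_zero g)
  smul_add g a b := Subtype.ext (smul_add g (incl S hS a) (incl S hS b))

theorem incl_smul (g : G) (a : StableSub S hS) : incl S hS (g • a) = g • incl S hS a := rfl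

instance : ContinuousSMul G (StableSub S hS) where
  continuous_smul := continuous_induced_rng.2
    ((continuous_fst.smul (continuous_subtype_val.comp continuous_snd) :
      Continuous fun p : G × StableSub S hS => p.1 • incl S hS p.2))

end StableSub

variable {S : AddSubgroup A} {hS : ∀ (g : G), ∀ a ∈ S, g • a ∈ S}

/-- Composition with the inclusion of a submodule of the coefficients. -/
def CHom.inclComp {M : Type*} [AddCommGroup M] [TopologicalSpace M]
    (φ : CHom M (StableSub S hS)) : CHom M A :=
  (⟨(StableSub.incl S hS).comp (φ : M →+ StableSub S hS),
    continuous_subtype_val.comp (map_continuous φ)⟩ : M →ₜ+ A)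

theorem CHom.inclComp_apply {M : Type*} [AddCommGroup M] [TopologicalSpace M]
    (φ : CHom M (StableSub S hS)) (m : M) : φ.inclComp m = StableSub.incl S hS (φ m) := rfl

theorem CHom.exists_inclComp_eq {M : Type*} [AddCommGroup M] [TopologicalSpace M] (φ : CHom M A)
    (h : ∀ m, φ m ∈ S) : ∃ φ₀ : CHom M (StableSub S hS), φ₀.inclComp = φ :=
  ⟨(⟨AddMonoidHom.codRestrict (φ : M →+ A) S h, Continuous.subtype_mk (map_continuous φ) h⟩ :
    M →ₜ+ S), rfl⟩

/-- A pair `(η, ζ)` whose values lie in a stable subgroup of `A` comes from a pair with values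
there. -/
theorem Bounds.exists_stableSub {η : cochains G (HomFree 𝒮 π A) 1} {ζ : cocycles G A 2}
    (h : Bounds π η ζ) (hη : ∀ v μ, η.1 v μ ∈ S) (hζ : ∀ v, ζ.1 v ∈ S) :
    ∃ (η₀ : cochains G (HomFree 𝒮 π (StableSub S hS)) 1) (ζ₀ : cocycles G (StableSub S hS) 2),
      Bounds π η₀ ζ₀ ∧ (∀ v, η.1 v = (η₀.1 v).inclComp) ∧
        ∀ v, ζ.1 v = StableSub.incl S hS (ζ₀.1 v) := by
  classical
  let L : HomFree 𝒮 π A → HomFree 𝒮 π (StableSub S hS) := fun φ =>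
    if hφ : ∀ m, φ m ∈ S then (CHom.exists_inclComp_eq (hS := hS) φ hφ).choose else 0
  have hL : ∀ φ : HomFree 𝒮 π A, (∀ m, φ m ∈ S) → (L φ).inclComp = φ := by
    intro φ hφ
    simp only [L, dif_pos hφ]
    exact (CHom.exists_inclComp_eq (hS := hS) φ hφ).choose_spec
  obtain ⟨hζc, hζd⟩ := mem_cocycles_two.1 ζ.2
  let ζ₀ : (Fin 2 → G) → StableSub S hS := fun v => (⟨ζ.1 v, hζ v⟩ : S)
  have hζ₀ : ∀ v, StableSub.incl S hS (ζ₀ v) = ζ.1 v := fun _ => rfl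
  have hζ₀c : Continuous ζ₀ := Continuous.subtype_mk hζc.continuous hζ
  have hζm : ζ₀ ∈ cocycles G (StableSub S hS) 2 := by
    refine mem_cocycles_two.2 ⟨(IsLocallyConstant.iff_continuous _).2 hζ₀c, fun g k l =>
      StableSub.incl_injective ?_⟩
    rw [map_sub, map_add, map_sub, StableSub.incl_smul, hζ₀, hζ₀, hζ₀, hζ₀, hζd, map_zero]
  let η₀ : cochains G (HomFree 𝒮 π (StableSub S hS)) 1 :=
    ⟨fun v => L (η.1 v), (show IsLocallyConstant η.1 from η.2).comp L⟩
  have hη₀ : ∀ v, (η₀.1 v).inclComp = η.1 v := fun v => hL _ (hη v)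
  have hη₀' : ∀ v m, StableSub.incl S hS (η₀.1 v m) = η.1 v m := fun v m => by
    rw [← hη₀, CHom.inclComp_apply]
  refine ⟨η₀, ⟨ζ₀, hζm⟩, bounds_iff.2 fun g k z => StableSub.incl_injective ?_,
    fun v => (hη₀ v).symm, fun _ => rfl⟩
  rw [map_add, map_sub, StableSub.incl_smul, hη₀', hη₀', hη₀']
  exact h.apply g k z

theorem resCochain_mem_coboundaries_of_stableSub {η : cochains G (HomFree 𝒮 π A) 1}
    {η₀ : cochains G (HomFree 𝒮 π (StableSub S hS)) 1} (hη : ∀ v, η.1 v = (η₀.1 v).inclComp)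
    (h : resCochain η₀ ∈ coboundaries G (HomDelta 𝒮 π (StableSub S hS)) 1) :
    resCochain η ∈ coboundaries G (HomDelta 𝒮 π A) 1 := by
  obtain ⟨κ, hκ⟩ := mem_coboundaries_one.1 h
  refine mem_coboundaries_one.2 ⟨κ.inclComp, fun g => CHom.ext fun μ => ?_⟩
  have h1 : η₀.1 ![g] (Delta.inc π _ μ) = g • κ (g⁻¹ • μ) - κ μ := by
    rw [sub_eq_add_neg]
    have h2 := DFunLike.congr_fun (hκ g) μ
    rwa [sub_eq_add_neg] at h2
  change η.1 ![g] (Delta.inc π _ μ) = _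
  rw [hη, CHom.inclComp_apply, h1, sub_eq_add_neg, sub_eq_add_neg, map_add, map_neg]
  rfl

theorem mem_coboundaries_two_of_stableSub {ζ : cocycles G A 2} {ζ₀ : cocycles G (StableSub S hS) 2}
    (hζ : ∀ v, ζ.1 v = StableSub.incl S hS (ζ₀.1 v))
    (h : ζ₀.1 ∈ coboundaries G (StableSub S hS) 2) : ζ.1 ∈ coboundaries G A 2 := by
  obtain ⟨b, hb, hbζ⟩ := mem_coboundaries_two.1 h
  refine mem_coboundaries_two.2 ⟨fun g => StableSub.incl S hS (b g), hb.comp _, fun g k => ?_⟩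
  rw [hζ, hbζ, map_add, map_sub, StableSub.incl_smul]

theorem CHom.nsmul_apply {M : Type*} [AddCommGroup M] [TopologicalSpace M] (n : ℕ)
    (φ : CHom M A) (m : M) : (n • φ) m = n • φ m :=
  map_nsmul (CHom.evalHom (A := A) m) n φ

theorem Bounds.nsmul {η : cochains G (HomFree 𝒮 π A) 1} {ζ : cocycles G A 2}
    (h : Bounds π η ζ) (n : ℕ) : Bounds π (n • η) (n • ζ) := by
  rw [bounds_iff] at h ⊢
  intro g k z
  change n • ζ.1 _ = g • (n • η.1 _ : HomFree 𝒮 π A) _ -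
    (n • η.1 _ : HomFree 𝒮 π A) _ + (n • η.1 _ : HomFree 𝒮 π A) _
  rw [h g k z, CHom.nsmul_apply, CHom.nsmul_apply, CHom.nsmul_apply, smul_add, smul_sub,
    smul_comm n g]

theorem IsClassOf.nsmul {c : relCohomologySucc 𝒮 π A 1} {η : cochains G (HomFree 𝒮 π A) 1}
    {ζ : cocycles G A 2} (hc : IsClassOf c η ζ) (n : ℕ) : IsClassOf (n • c) (n • η) (n • ζ) := by
  obtain ⟨⟨ξ, hξ, h2⟩, h1⟩ := hc
  refine ⟨⟨n • ξ, ?_, ?_⟩, fun hX => ?_⟩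
  · change n • ξ.1 = _
    rw [hξ]
    exact funext fun g => (map_nsmul (resDelta π 𝒮.CosetSpace A) n (η.1 g)).symm
  · change n • c.1.2 = _
    rw [h2]; rfl
  · change n • c.1.1 = _
    rw [h1 hX]; rfl

/-- If `n A` lies in a submodule `S` with `H²(G, 𝒮; S) = 0`, then `n` kills `H²(G, 𝒮; A)`, since the
multiplication by `n` on `A` factors through `S`. -/
theorem IsClassOf.nsmul_eq_zero {c : relCohomologySucc 𝒮 π A 1}
    {η : cochains G (HomFree 𝒮 π A) 1} {ζ : cocycles G A 2} (hc : IsClassOf c η ζ)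
    (h : Bounds π η ζ) (n : ℕ) (hn : ∀ a : A, n • a ∈ S) (hπ : PiTorsion π (StableSub S hS))
    (h0 : ∀ c₀ : relCohomologySucc 𝒮 π (StableSub S hS) 1, c₀ = 0) : n • c = 0 := by
  obtain ⟨η₀, ζ₀, h₀, hη, hζ⟩ := (h.nsmul n).exists_stableSub (hS := hS)
    (fun v μ => by
      change (n • η.1 v : HomFree 𝒮 π A) μ ∈ S
      rw [CHom.nsmul_apply]; exact hn _)
    (fun v => hn _)
  obtain ⟨c₀, hc₀⟩ := h₀.exists_isClassOf hπ
  obtain ⟨h1, h2⟩ := hc₀.eq_zero_iff.1 (h0 c₀)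
  exact (hc.nsmul n).eq_zero_iff.2 ⟨resCochain_mem_coboundaries_of_stableSub hη h1,
    fun hX => mem_coboundaries_two_of_stableSub hζ (h2 hX)⟩

/-- The `p`-primary subgroup. -/
def primaryPart (A : Type*) [AddCommGroup A] (p : ℕ) : AddSubgroup A where
  carrier := {a | ∃ k : ℕ, p ^ k • a = 0}
  zero_mem' := ⟨0, smul_zero _⟩
  add_mem' := by
    rintro a b ⟨k, hk⟩ ⟨l, hl⟩
    exact ⟨k + l, by rw [smul_add, pow_add, mul_smul, mul_smul, hl, smul_zero, add_zero,
      smul_comm, hk, smul_zero]⟩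
  neg_mem' := by
    rintro a ⟨k, hk⟩
    exact ⟨k, by rw [smul_neg, hk, neg_zero]⟩

theorem smul_mem_primaryPart (p : ℕ) (g : G) (a : A) (ha : a ∈ primaryPart A p) :
    g • a ∈ primaryPart A p := by
  obtain ⟨k, hk⟩ := ha
  exact ⟨k, by rw [smul_comm, hk, smul_zero]⟩

theorem piTorsion_of_primary {p : Nat.Primes} (hp : p ∈ π) {A : Type*} [AddCommGroup A]
    (h : ∀ a : A, ∃ k : ℕ, (p : ℕ) ^ k • a = 0) : PiTorsion π A := by
  intro a
  obtain ⟨k, hk⟩ := h a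
  refine ⟨(p : ℕ) ^ k, pow_pos p.2.pos k, hk, fun q hq => ?_⟩
  rwa [Subtype.ext ((Nat.prime_dvd_prime_iff_eq q.2 p.2).1 (q.2.dvd_of_dvd_pow hq)) (a1 := q)]

theorem piTorsion_of_finite {A : Type*} [AddCommGroup A] [Finite A]
    (h : ∀ (a : A) (p : Nat.Primes), (p : ℕ) ∣ addOrderOf a → p ∈ π) : PiTorsion π A :=
  fun a => ⟨addOrderOf a, addOrderOf_pos a, addOrderOf_nsmul_eq_zero a, h a⟩

theorem eq_zero_of_coprime_nsmul {M : Type*} [AddCommGroup M] {a b : ℕ} (hab : a.Coprime b) {x : M}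
    (ha : a • x = 0) (hb : b • x = 0) : x = 0 := by
  rw [← AddMonoid.addOrderOf_eq_one_iff, ← Nat.dvd_one, ← hab.gcd_eq_one]
  exact Nat.dvd_gcd (addOrderOf_dvd_of_nsmul_eq_zero ha) (addOrderOf_dvd_of_nsmul_eq_zero hb)

/-- If `cd_p(G, 𝒮) ≤ 1` for all primes `p` dividing the order of the finite module `A`, then
`H²(G, 𝒮; A) = 0`. The proof is by induction on a number which kills `A`: a prime power is handled by
the `p`-primary part, and for a product of coprime numbers the class is killed by both. -/
theorem eq_zero_of_relCdLE [Finite A] {T : Set Nat.Primes} (hT : T ⊆ π)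
    (hcd : ∀ p ∈ T, RelCdLE 𝒮 π p 1)
    (hA : ∀ (a : A) (p : Nat.Primes), (p : ℕ) ∣ addOrderOf a → p ∈ T)
    (c : relCohomologySucc 𝒮 π A 1) : c = 0 := by
  have hAπ : PiTorsion π A := piTorsion_of_finite fun a p hp => hT (hA a p hp)
  obtain ⟨η, ζ, h, hc⟩ := exists_bounds_isClassOf hAπ c
  suffices key : ∀ n : ℕ, 0 < n → (∀ p : Nat.Primes, (p : ℕ) ∣ n → p ∈ T) →
      ∀ m : ℕ, (∀ a : A, n • m • a = 0) → m • c = 0 by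
    have h1 := key (Nat.card A) Nat.card_pos (fun p hp => by
      obtain ⟨a, ha⟩ := exists_prime_addOrderOf_dvd_card' (p : ℕ) hp
      exact hA a p (by rw [ha])) 1 fun a => by rw [one_smul]; exact card_nsmul_eq_zero'
    rwa [one_smul] at h1
  intro n
  induction n using Nat.recOnPosPrimePosCoprime with
  | prime_pow p k hp hk =>
    intro _ hpT m hm
    obtain ⟨P, rfl⟩ : ∃ P : Nat.Primes, (P : ℕ) = p := ⟨⟨p, hp⟩, rfl⟩
    have hP : P ∈ T := hpT P (dvd_pow_self _ hk.ne')
    have hprim : ∀ a : StableSub (G := G) (primaryPart A P) (smul_mem_primaryPart _),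
        ∃ k : ℕ, (P : ℕ) ^ k • a = 0 := by
      intro a
      obtain ⟨k, hk⟩ := StableSub.incl_mem a
      exact ⟨k, StableSub.incl_injective (by rw [map_nsmul, hk, map_zero])⟩
    exact hc.nsmul_eq_zero (hS := smul_mem_primaryPart (P : ℕ)) h m (fun a => ⟨k, hm a⟩)
      (piTorsion_of_primary (hT hP) hprim) (hcd P hP _ hprim)
  | zero => exact fun h => (lt_irrefl _ h).elim
  | one =>
    intro _ _ m hm
    have hm : ∀ a : A, m • a = 0 := fun a => by rw [← hm a, one_smul]
    refine (hc.nsmul m).eq_zero_iff.2 ⟨?_, fun _ => ?_⟩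
    · refine mem_coboundaries_one.2 ⟨0, fun g => CHom.ext fun μ => ?_⟩
      change (m • η.1 ![g] : HomFree 𝒮 π A) _ = _
      rw [CHom.nsmul_apply, hm, smul_zero, sub_zero]; rfl
    · refine mem_coboundaries_two.2 ⟨fun _ => 0, IsLocallyConstant.const 0, fun g k => ?_⟩
      change m • ζ.1 _ = _
      rw [hm, smul_zero, sub_zero, add_zero]
  | coprime a b ha hb hab iha ihb =>
    intro _ hT' m hm
    have h1 := iha (by lia) (fun p hp => hT' p (hp.mul_right b)) (b * m)
      fun x => by rw [mul_smul, ← mul_smul, hm]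
    have h2 := ihb (by lia) (fun p hp => hT' p (hp.mul_left a)) (a * m)
      fun x => by rw [mul_smul, ← mul_smul, mul_comm, hm]
    rw [mul_smul] at h1 h2
    exact eq_zero_of_coprime_nsmul hab h2 h1

/-- A finite subset of a torsion module lies in a finite submodule, as its orbits are finite. -/
theorem exists_finite_stable (hA : PiTorsion π A) {V : Set A} (hV : V.Finite) :
    ∃ S : AddSubgroup A, Finite S ∧ (∀ (g : G), ∀ a ∈ S, g • a ∈ S) ∧ V ⊆ S := by
  let W : Set A := ⋃ a ∈ V, Set.range fun g : G => g • a
  have hW : W.Finite := hV.biUnion fun a _ =>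
    (isCompact_range (continuous_id.smul continuous_const)).finite_of_discrete
  refine ⟨AddSubgroup.closure W, ?_, fun g a ha => ?_, fun a ha => AddSubgroup.subset_closure
    (Set.mem_biUnion ha ⟨1, one_smul G a⟩)⟩
  · have : AddGroup.FG (AddSubgroup.closure W) :=
      (AddGroup.fg_iff_addSubgroup_fg _).2 ⟨hW.toFinset, by rw [hW.coe_toFinset]⟩
    refine AddCommGroup.finite_of_fg_isAddTorsion _ fun a => ?_
    obtain ⟨n, hn, hna, -⟩ := hA a.1
    exact isOfFinAddOrder_iff_nsmul_eq_zero.2 ⟨n, hn, Subtype.ext hna⟩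
  · induction ha using AddSubgroup.closure_induction with
    | mem x hx =>
      obtain ⟨a, ha, k, rfl⟩ := Set.mem_iUnion₂.1 hx
      exact AddSubgroup.subset_closure (Set.mem_biUnion ha ⟨g * k, mul_smul g k a⟩)
    | zero => rw [smul_zero]; exact zero_mem _
    | add x y _ _ hx hy => rw [smul_add]; exact add_mem hx hy
    | neg x _ hx => rw [smul_neg]; exact neg_mem hx

end Coefficients

/-! ### Lifting problems defined by relative extensions -/

section Converse

variable {G X : Type u} [Group G] [TopologicalSpace G] [IsTopologicalGroup G] [CompactSpace G]
  [TotallyDisconnectedSpace G] [TopologicalSpace X] {𝒮 : SubgroupFamily G X}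
  {A : Type u} [AddCommGroup A] [DistribMulAction G A] [TopologicalSpace A]
  [DiscreteTopology A] [ContinuousSMul G A] {C : FiniteGroupVariety}

namespace RelExtension

/-- An extension of a pro-`𝒞` group by a finite `p`-group is pro-`𝒞`, if `𝒞` is closed under
extensions and contains a group of order divisible by `p`. -/
theorem isPro (hC : C.ExtensionClosed) (hG : C.IsPro G) {p : Nat.Primes} (hp : p ∈ C.primes)
    (hA : ∀ a : A, ∃ k : ℕ, (p : ℕ) ^ k • a = 0) (R : RelExtension 𝒮 A) : C.IsPro R.E := by
  intro N _ hN
  let K : Subgroup G := N.map R.proj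
  have : K.Normal := Subgroup.Normal.map inferInstance _ R.ext.rightHom_surjective
  have hK : IsOpen (K : Set G) := by
    rw [← R.isQuotientMap_proj.isOpen_preimage]
    exact Subgroup.isOpen_mono (H₁ := N) (H₂ := K.comap R.proj) (Subgroup.le_comap_map _ _) hN
  have : Finite (R.E ⧸ N) := by
    have := QuotientGroup.discreteTopology hN
    exact finite_of_compact_of_discrete
  let f : R.E ⧸ N →* G ⧸ K := QuotientGroup.map N K R.proj (Subgroup.le_comap_map _ _)
  have hf : Function.Surjective f := by
    intro y
    obtain ⟨g, rfl⟩ := QuotientGroup.mk_surjective y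
    obtain ⟨e, rfl⟩ := R.ext.rightHom_surjective g
    exact ⟨(e : R.E ⧸ N), rfl⟩
  refine FiniteGroupVariety.Contains.of_surjective hC f hf
    (FiniteGroupVariety.contains_of_isPGroup hC hp ?_) (hG K hK)
  rintro ⟨y, hy⟩
  obtain ⟨e, rfl⟩ := QuotientGroup.mk_surjective y
  have he : R.proj e ∈ K := (QuotientGroup.eq_one_iff _).1 hy
  obtain ⟨n, hn, hne⟩ := he
  obtain ⟨a, rfl⟩ := R.exists_incl_mul hne
  obtain ⟨k, hk⟩ := hA a
  refine ⟨k, Subtype.ext ?_⟩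
  have h1 : ((R.incl a * n : R.E) : R.E ⧸ N) = (R.incl a : R.E) :=
    QuotientGroup.mk_mul_of_mem _ hn
  change ((R.incl a * n : R.E) : R.E ⧸ N) ^ _ = 1
  rw [h1, ← QuotientGroup.mk_pow]
  have h2 : R.incl a ^ (p : ℕ) ^ k = R.incl ((p : ℕ) ^ k • a) :=
    (map_pow R.ext.inl _ _).symm
  rw [h2, hk, incl_zero, QuotientGroup.mk_one]

/-- The problem of lifting the identity of `G` to the relative extension `R`. -/
def toLiftingProblem (R : RelExtension 𝒮 A) (hG : C.IsPro G) (hE : C.IsPro R.E) :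
    LiftingProblem C 𝒮 where
  H := R.E
  Q := ProfiniteGrp.of G
  isPro_H := hE
  isPro_Q := hG
  α := R.proj
  continuous_α := R.continuous_rightHom
  surjective_α := R.ext.rightHom_surjective
  φ := MonoidHom.id G
  continuous_φ := continuous_id
  σ := R.q
  continuous_σ := R.continuous_q
  σ_mul := R.q_mul
  α_σ := R.rightHom_q

theorem toLiftingProblem_finiteAbelianKernel [Finite A] (R : RelExtension 𝒮 A) (hG : C.IsPro G)
    (hE : C.IsPro R.E) : (R.toLiftingProblem hG hE).FiniteAbelianKernel where
  finite := by
    refine Finite.of_surjective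
      (fun a : A => (⟨R.incl a, R.proj_incl a⟩ : (R.toLiftingProblem hG hE).α.ker)) ?_
    rintro ⟨e, he⟩
    obtain ⟨a, rfl⟩ := R.exists_incl_of_proj_eq_one he
    exact ⟨a, rfl⟩
  comm := by
    rintro ⟨e, he⟩ ⟨e', he'⟩
    obtain ⟨a, rfl⟩ := R.exists_incl_of_proj_eq_one he
    obtain ⟨b, rfl⟩ := R.exists_incl_of_proj_eq_one he'
    refine Subtype.ext ?_
    change R.incl a * R.incl b = R.incl b * R.incl a
    rw [← incl_add, ← incl_add, add_comm]

theorem splits_of_hasSolution [Finite A] (R : RelExtension 𝒮 A) (hG : C.IsPro G)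
    (hE : C.IsPro R.E) (h : (R.toLiftingProblem hG hE).HasSolution) : R.Splits := by
  obtain ⟨s, c, hs, hc, hps, hsq⟩ := h
  let P := R.toLiftingProblem hG hE
  have hc' : Continuous fun x => (c x : P.H) :=
    (continuous_subtype_val (p := fun e : P.H => e ∈ P.α.ker)).comp hc
  have hex : ∀ x, ∃ a, R.incl a = (c x).1 := fun x => R.exists_incl_of_proj_eq_one (c x).2
  choose a ha using hex
  have hemb : IsClosedEmbedding R.incl := R.continuous_incl.isClosedEmbedding R.incl_injective
  refine ⟨s, a, hs, hemb.isInducing.continuous_iff.2 ?_, hps, fun t => ?_⟩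
  · rw [show R.incl ∘ a = fun x => (c x).1 from funext ha]
    exact hc'
  · rw [ha]
    exact hsq t

end RelExtension

/-- If all lifting problems with finite abelian kernel have solutions, then `cd_p(G, 𝒮) ≤ 1`. The
values of cochains representing a class lie in a finite submodule, and the corresponding relative
extension is a lifting problem. -/
theorem relCdLE_one_of_hasSolution [CompactSpace X] {π : Set Nat.Primes}
    (hC : C.ExtensionClosed) (hG : C.IsPro G) (hπ : C.primes ⊆ π)
    (h : ∀ (P : LiftingProblem C 𝒮) [P.FiniteAbelianKernel], P.HasSolution) {p : Nat.Primes}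
    (hp : p ∈ C.primes) : RelCdLE 𝒮 π p 1 := by
  intro A _ _ _ _ _ hA c
  have hAπ : PiTorsion π A := piTorsion_of_primary (hπ hp) hA
  obtain ⟨η, ζ, hb, hc⟩ := exists_bounds_isClassOf hAπ c
  let V : Set A := (⋃ φ ∈ Set.range η.1, Set.range φ) ∪ Set.range ζ.1
  have hV : V.Finite := by
    refine Set.Finite.union (Set.Finite.biUnion ?_ fun φ _ => ?_) ?_
    · exact (show IsLocallyConstant η.1 from η.2).range_finite
    · exact (isCompact_range (map_continuous φ)).finite_of_discrete
    · exact (show IsLocallyConstant ζ.1 from ζ.2.1).range_finite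
  obtain ⟨S, hSfin, hS, hVS⟩ := exists_finite_stable (G := G) hAπ hV
  obtain ⟨η₀, ζ₀, hb₀, hη, hζ⟩ := hb.exists_stableSub (hS := hS)
    (fun v μ => hVS (Or.inl (Set.mem_biUnion ⟨v, rfl⟩ ⟨μ, rfl⟩))) fun v => hVS (Or.inr ⟨v, rfl⟩)
  have : Finite (StableSub S hS) := hSfin
  have hA₀ : ∀ a : StableSub S hS, ∃ k : ℕ, (p : ℕ) ^ k • a = 0 := by
    intro a
    obtain ⟨k, hk⟩ := hA (StableSub.incl S hS a)
    exact ⟨k, StableSub.incl_injective (by rw [map_nsmul, hk, map_zero])⟩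
  let R := RelExtension.ofCochains η₀ ζ₀ hb₀
  have hE : C.IsPro R.E := R.isPro hC hG hp hA₀
  have := R.toLiftingProblem_finiteAbelianKernel hG hE
  obtain ⟨b, a, hab⟩ := (RelExtension.ofCochains_splits_iff hb₀).1
    (R.splits_of_hasSolution hG hE (h _))
  obtain ⟨h1, h2⟩ := hab.mem_coboundaries (piTorsion_of_primary (hπ hp) hA₀) hb₀
  exact hc.eq_zero_iff.2 ⟨resCochain_mem_coboundaries_of_stableSub hη h1,
    fun _ => mem_coboundaries_two_of_stableSub hζ h2⟩

theorem LiftingProblem.mem_primes_of_dvd_addOrderOf (P : LiftingProblem C 𝒮)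
    [P.FiniteAbelianKernel] (a : P.KerModule) (p : Nat.Primes) (hp : (p : ℕ) ∣ addOrderOf a) :
    p ∈ C.primes := by
  let f : Multiplicative P.KerModule →* P.H :=
    { toFun := fun a => KerModule.val a.toAdd
      map_one' := rfl
      map_mul' := fun _ _ => rfl }
  have hf : Function.Injective f := KerModule.val_injective
  have h1 : orderOf (f (Multiplicative.ofAdd a)) = addOrderOf a := by
    rw [orderOf_injective f hf, orderOf_ofAdd_eq_addOrderOf]
  refine P.isPro_H.mem_primes (h := f (Multiplicative.ofAdd a)) ?_ (by rwa [h1])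
  rw [← orderOf_pos_iff, h1]
  exact addOrderOf_pos a

end Converse

end

end RelCoh

theorem mainTheorem5 {G X : Type u}
    [Group G] [TopologicalSpace G] [IsTopologicalGroup G] [CompactSpace G]
    [TotallyDisconnectedSpace G]
    [TopologicalSpace X] [CompactSpace X] [T2Space X] [TotallyDisconnectedSpace X]
    (C : FiniteGroupVariety) (hG : C.IsPro G) (𝒮 : SubgroupFamily G X)
    (π : Set Nat.Primes) (hπ : C.primes ⊆ π) :
    (∀ (P : LiftingProblem C 𝒮) [P.FiniteAbelianKernel],
      (∃! c : relCohomologySucc 𝒮 π P.KerModule 1, P.pullback.Represents π c) ∧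
      (P.HasSolution ↔ P.pullback.Represents π 0)) ∧
    ((∀ p ∈ C.primes, RelCdLE 𝒮 π p 1) →
      ∀ (P : LiftingProblem C 𝒮) [P.FiniteAbelianKernel], P.HasSolution) ∧
    (C.ExtensionClosed →
      ((∀ (P : LiftingProblem C 𝒮) [P.FiniteAbelianKernel], P.HasSolution) ↔
        ∀ p ∈ C.primes, RelCdLE 𝒮 π p 1)) := by
  have hπP : ∀ (P : LiftingProblem C 𝒮) [P.FiniteAbelianKernel], PiTorsion π P.KerModule :=
    fun P _ => piTorsion_of_finite fun a p hp => hπ (P.mem_primes_of_dvd_addOrderOf a p hp)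
  have hsol : ∀ (P : LiftingProblem C 𝒮) [P.FiniteAbelianKernel],
      P.HasSolution ↔ P.pullback.Represents π 0 := fun P _ =>
    P.hasSolution_iff_splits.trans (P.pullback.splits_iff_represents_zero (hπP P))
  have hcd : (∀ p ∈ C.primes, RelCdLE 𝒮 π p 1) →
      ∀ (P : LiftingProblem C 𝒮) [P.FiniteAbelianKernel], P.HasSolution := by
    intro h P _
    obtain ⟨c, hc, -⟩ := P.pullback.existsUnique_represents (hπP P)
    have hc0 : c = 0 := eq_zero_of_relCdLE hπ h P.mem_primes_of_dvd_addOrderOf c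
    rw [hsol, ← hc0]
    exact hc
  exact ⟨fun P _ => ⟨P.pullback.existsUnique_represents (hπP P), hsol P⟩, hcd,
    fun hC => ⟨fun h p hp => relCdLE_one_of_hasSolution hC hG hπ h hp, hcd⟩⟩
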